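/- Let $n\ge 1$ banks have asset holdings $a_i>0$ and cash shortfalls $h_i>0$, let $r\ge 0$ be the repo rate, let $M\ge\sum_{i=1}^n a_i$, and put $\mathbb D=\prod_{i=1}^n[0,a_i]$, $\vec a=(a_1,\dots,a_n)$. Let $f:[0,M]\to(0,1]$ (order book density) be strictly decreasing and twice continuously differentiable with $f(0)=1$ and $f'$ nondecreasing. For $\vec s\in\mathbb D$ let the average prices $\bar f_i(\vec s)$ be given by one of the following two structures. VWAP: $\bar f_i(\vec 0)=1$ and $\bar f_i(\vec s)=\frac{1}{\sum_j s_j}\int_0^{\sum_j s_j}f(\sigma)\,d\sigma$ for $\vec s\neq\vec 0$. LOB: $\bar f_i(\vec s)=1$ if $s_i=0$, and if $s_i>0$, $$\bar f_i(\vec s)=\frac1{s_i}\sum_{j=1}^{k}\frac1{n-(j-1)}\int_{\sum_{l=1}^{j-1}(n-(l-1))(s_{[l]}-s_{[l-1]})}^{\sum_{l=1}^{j}(n-(l-1))(s_{[l]}-s_{[l-1]})}f(\sigma)\,d\sigma ,$$ where $0=:s_{[0]}\le s_{[1]}\le\dots\le s_{[n]}$ are the order statistics of $\vec s$ and $s_i=s_{[k]}$.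 Let $g:[0,M]\to(0,1]$ (haircut function) be continuous, convex and strictly decreasing, with $\min_i\bar f_i(\vec s)>g(\sum_j s_j)$ for every $\vec s\in\mathbb D$, and assume that for every $i$ and every $\vec s_{-i}\in\prod_{j\ne i}[0,a_j]$ the map $s_i\in[0,a_i]\mapsto s_i\bar f_i(s_i,\vec s_{-i})+(a_i-s_i)\,g(\sum_j s_j)$ is strictly increasing. A pair $(q,\bar{\vec q})\in\mathbb R\times\mathbb R^n$ is called a clearing haircut and set of actualized prices if there is $\vec s\in\mathbb D$ such that $q=g(\sum_j s_j)$, $\bar q_i=\bar f_i(\vec s)$ for all $i$, and $\vec s$ is a Nash equilibrium of the liquidation game at the fixed prices $(q,\bar{\vec q})$; that is, for every bank $i$: if $h_i\le a_i\bar q_i$, then $s_i$ minimizes $$x\mapsto x\,(1-\bar f_i(x,\vec s_{-i}))+r\,(h_i-x\,\bar f_i(x,\vec s_{-i}))$$ over all $x\in[0,a_i]$ with $\frac{h_i-a_iq}{\bar q_i-q}\le x\le\frac{h_i}{\bar q_i}$; if $h_i>a_i\bar q_i$, then $s_i=a_i$. Assume that all banks are fundamentally solvent, i.e. $h_i\le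 a_i\bar f_i(\vec a)$ for all $i$, that $g$ has a finite (one-sided) derivative $g'(0)$ at $0$, and that $$-c\,M\,\min\{c_1f'(0),\,g'(0)\}<\min_{j}\min_{\vec s\in\mathbb D}\Big(\bar f_j(\vec s)-g\big(\textstyle\sum_i s_i\big)\Big),$$ where $(c,c_1)=(3,\tfrac12)$ for VWAP and $(c,c_1)=(n,\tfrac n2)$ for LOB. Then there exists exactly one clearing haircut and set of actualized prices $(q^*,\bar{\vec q}^{\,*})$. -/

import Mathlib

namespace RepoFireSale

open Set

/-- The set `∏ⱼ [0, aⱼ]` of feasible liquidation vectors. -/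
def liquidationSet {n : ℕ} (a : Fin n → ℝ) : Set (Fin n → ℝ) :=
  {s | ∀ i, s i ∈ Icc 0 (a i)}

/-! ### Average prices -/

/-- The common volume weighted average price obtained from the order book density `f` when the
liquidations are `s`. -/
noncomputable def vwapPrice {n : ℕ} (f : ℝ → ℝ) (s : Fin n → ℝ) : ℝ :=
  if s = 0 then 1 else (∫ σ in (0 : ℝ)..(∑ j, s j), f σ) / ∑ j, s j

/-- Order statistics: `orderStat s 0 = 0`, and `orderStat s k` is the `k`-th smallest entry of `s`
for `1 ≤ k ≤ n` (the value `0` for `k > n` is never used). -/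
noncomputable def orderStat {n : ℕ} (s : Fin n → ℝ) : ℕ → ℝ
  | 0 => 0
  | k + 1 => if hk : k < n then s (Tuple.sort s ⟨k, hk⟩) else 0

/-- A rank `k ∈ {1, …, n}` with `orderStat s k = s i`. -/
noncomputable def rank {n : ℕ} (s : Fin n → ℝ) (i : Fin n) : ℕ :=
  ((Tuple.sort s).symm i : ℕ) + 1

theorem orderStat_rank {n : ℕ} (s : Fin n → ℝ) (i : Fin n) : orderStat s (rank s i) = s i := by
  simp [orderStat, rank]

/-- The depth `∑_{l=1}^{j} (n - (l - 1)) (s_[l] - s_[l-1])` of the book that has been consumed when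
each bank has traded `min(sᵢ, s_[j])`; the summation index here is `l - 1`. -/
noncomputable def bookDepth {n : ℕ} (s : Fin n → ℝ) (j : ℕ) : ℝ :=
  ∑ l ∈ Finset.range j, ((n : ℝ) - (l : ℝ)) * (orderStat s (l + 1) - orderStat s l)

/-- The average limit order book price of bank `i`; the summation index `j` here is one less than
the usual one, that is, it runs over `0, …, k - 1` where `s_[k] = sᵢ`. -/
noncomputable def lobPrice {n : ℕ} (f : ℝ → ℝ) (s : Fin n → ℝ) (i : Fin n) : ℝ :=
  if s i = 0 then 1
  else 1 / s i * ∑ j ∈ Finset.range (rank s i),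
    1 / ((n : ℝ) - (j : ℝ)) * ∫ σ in (bookDepth s j)..(bookDepth s (j + 1)), f σ

/-- The two market structures. -/
inductive Market where
  | vwap : Market
  | lob : Market

/-- The average price `f̄ᵢ(s)` obtained by bank `i` under a market structure. -/
noncomputable def Market.avgPrice {n : ℕ} (m : Market) (f : ℝ → ℝ) (i : Fin n)
    (s : Fin n → ℝ) : ℝ :=
  match m with
  | .vwap => vwapPrice f s
  | .lob => lobPrice f s i

/-- The constant `c`: `3` for volume weighted prices, `n` for the limit order book. -/
noncomputable def Market.c (m : Market) (n : ℕ) : ℝ :=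
  match m with
  | .vwap => 3
  | .lob => n

/-- The constant `c₁`: `1/2` for volume weighted prices, `n/2` for the limit order book. -/
noncomputable def Market.c₁ (m : Market) (n : ℕ) : ℝ :=
  match m with
  | .vwap => 1 / 2
  | .lob => (n : ℝ) / 2

/-! ### Standing assumptions -/

/-- Assumptions on the order book density `f : [0, M] → (0, 1]`. -/
structure IsOrderBookDensity (M : ℝ) (f : ℝ → ℝ) : Prop where
  mapsTo : MapsTo f (Icc 0 M) (Ioc 0 1)
  strictAnti : StrictAntiOn f (Icc 0 M)
  contDiff : ContDiffOn ℝ 2 f (Icc 0 M)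
  at_zero : f 0 = 1
  deriv_mono : MonotoneOn (derivWithin f (Icc 0 M)) (Icc 0 M)

/-- Assumptions on the haircut function `g : [0, M] → (0, 1]`, given the average prices `fbar`. -/
structure IsHaircut {n : ℕ} (M : ℝ) (a : Fin n → ℝ) (fbar : Fin n → (Fin n → ℝ) → ℝ)
    (g : ℝ → ℝ) : Prop where
  mapsTo : MapsTo g (Icc 0 M) (Ioc 0 1)
  continuousOn : ContinuousOn g (Icc 0 M)
  convexOn : ConvexOn ℝ (Icc 0 M) g
  strictAnti : StrictAntiOn g (Icc 0 M)
  lt_price : ∀ s ∈ liquidationSet a, ∀ i, g (∑ j, s j) < fbar i s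

/-- For every bank, the total cash that it can raise by selling and borrowing is strictly
increasing in its own liquidations. -/
def CashStrictMono {n : ℕ} (a : Fin n → ℝ) (fbar : Fin n → (Fin n → ℝ) → ℝ) (g : ℝ → ℝ) : Prop :=
  ∀ i, ∀ s ∈ liquidationSet a,
    StrictMonoOn
      (fun x : ℝ => x * fbar i (Function.update s i x)
        + (a i - x) * g (∑ j, Function.update s i x j))
      (Icc 0 (a i))

/-- Bank `i` can cover its shortfall in any case. -/
def FundamentallySolvent {n : ℕ} (a h : Fin n → ℝ) (fbar : Fin n → (Fin n → ℝ) → ℝ)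
    (i : Fin n) : Prop :=
  h i ≤ a i * fbar i a

/-! ### The game -/

/-- The cost to bank `i` of liquidating `x` when the others liquidate according to `s`: the
realized loss plus the interest on the remaining shortfall. -/
noncomputable def cost {n : ℕ} (r : ℝ) (h : Fin n → ℝ) (fbar : Fin n → (Fin n → ℝ) → ℝ)
    (s : Fin n → ℝ) (i : Fin n) (x : ℝ) : ℝ :=
  x * (1 - fbar i (Function.update s i x)) + r * (h i - x * fbar i (Function.update s i x))

/-- The liquidations `x ∈ [0, aᵢ]` that are admissible for bank `i` at the haircut `q` and the
prices `qbar`. -/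
def admissible {n : ℕ} (a h : Fin n → ℝ) (q : ℝ) (qbar : Fin n → ℝ) (i : Fin n) : Set ℝ :=
  {x | x ∈ Icc 0 (a i) ∧ x ≤ h i / qbar i ∧ (h i - a i * q) / (qbar i - q) ≤ x}

/-- `s` is a Nash equilibrium of the liquidation game with fixed haircut `q` and prices `qbar`:
a solvent bank minimizes its cost over the admissible liquidations, an insolvent bank liquidates
everything. -/
def IsNashEquilibrium {n : ℕ} (a h : Fin n → ℝ) (r : ℝ) (fbar : Fin n → (Fin n → ℝ) → ℝ)
    (q : ℝ) (qbar : Fin n → ℝ) (s : Fin n → ℝ) : Prop :=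
  ∀ i, (h i ≤ a i * qbar i →
          s i ∈ admissible a h q qbar i ∧
            ∀ x ∈ admissible a h q qbar i, cost r h fbar s i (s i) ≤ cost r h fbar s i x) ∧
       (a i * qbar i < h i → s i = a i)

/-- `(q, qbar)` is a clearing haircut together with actualized prices: they are reproduced by the
liquidations of a Nash equilibrium of the game at these prices. -/
def IsClearing {n : ℕ} (a h : Fin n → ℝ) (r : ℝ) (fbar : Fin n → (Fin n → ℝ) → ℝ) (g : ℝ → ℝ)
    (p : ℝ × (Fin n → ℝ)) : Prop :=
  ∃ s ∈ liquidationSet a,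
    IsNashEquilibrium a h r fbar p.1 p.2 s ∧
      p.1 = g (∑ j, s j) ∧ ∀ i, p.2 i = fbar i s

end RepoFireSale

namespace RepoFireSale

open Set

/-! ### Integrals of antitone functions -/

/-! In both markets the revenue of a bank is the integral of its marginal prices, and these decrease
with its own sales. Its cost is therefore convex in its own sales. Since solvency at `a` persists at
every feasible profile, equilibria that reproduce their own prices are described by first order
conditions (`isClearing_iff`). With `ρ = (1 + r)⁻¹`, the marginal price is at most `ρ` unless the
bank has covered its shortfall by sales, and at least `ρ` unless it sells nothing or its borrowing
constraint binds.

For volume weighted prices everything depends on the total `S` and the bank's own sales. Existence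
follows from the intermediate value theorem in `S`: each bank sells a common level, clamped between
its two bounds (`exists_vwap`). For uniqueness, suppose that the total grows from `S` to `S'`
(`not_vwap_lt`). A bank constrained by its shortfall or its cash can grow only by a controlled
amount, and the smallness assumption rules out that all banks are of this kind. Any other bank must
hold more than half of `S`, and its share of the total must shrink (`vwap_scaling`). All remaining
banks have covered their shortfalls by sales, so their shares do not grow, which is impossible
because shares sum to one.

For the limit order book, bank `i` receives the integral over `[0, sᵢ]` of `f` at the depth `∑ⱼ min
(sⱼ, t)` (`mul_lobPrice_eq_integral`), so what happens below a level `t` depends only on the profile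
truncated at `t`. Existence takes two least fixed points of monotone maps (`exists_lob`). For
uniqueness, a bank that sells more in one equilibrium than in another must be cash constrained in
the former (`lob_cash_eq`); the Lipschitz bounds then turn this into a contraction for the sum of
the positive parts of the differences (`lob_le`). A single bank is handled by strict monotonicity of
its cash (`lob_single_le`). -/

theorem integral_le_of_antitoneOn {m : ℝ → ℝ} {x y : ℝ} (hxy : x ≤ y)
    (hc : ContinuousOn m (Icc x y)) (hm : AntitoneOn m (Icc x y)) :
    (y - x) * m y ≤ ∫ t in x..y, m t ∧ ∫ t in x..y, m t ≤ (y - x) * m x := by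
  have hi : IntervalIntegrable m MeasureTheory.volume x y :=
    ContinuousOn.intervalIntegrable (by rwa [uIcc_of_le hxy])
  constructor
  · have := intervalIntegral.integral_mono_on hxy (intervalIntegrable_const (c := m y)) hi
      (fun t ht => hm ht (right_mem_Icc.2 hxy) ht.2)
    simpa using this
  · have := intervalIntegral.integral_mono_on hxy hi (intervalIntegrable_const (c := m x))
      (fun t ht => hm (left_mem_Icc.2 hxy) ht ht.1)
    simpa using this

/-- First order conditions for the minimization of `x - (1 + r) ∫₀ˣ m` over an interval. -/
theorem forall_cost_le_iff {m : ℝ → ℝ} {A r l u s : ℝ} (hr : 0 ≤ r)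
    (hc : ContinuousOn m (Icc 0 A)) (hm : AntitoneOn m (Icc 0 A))
    (hl : 0 ≤ l) (hls : l ≤ s) (hsu : s ≤ u) (hu : u ≤ A) :
    (∀ x ∈ Icc l u, s - (1 + r) * ∫ t in (0 : ℝ)..s, m t ≤ x - (1 + r) * ∫ t in (0 : ℝ)..x, m t) ↔
      (s < u → m s ≤ (1 + r)⁻¹) ∧ (l < s → (1 + r)⁻¹ ≤ m s) := by
  have hr1 : 0 < 1 + r := by linarith
  have hint : ∀ x y, 0 ≤ x → x ≤ A → 0 ≤ y → y ≤ A →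
      IntervalIntegrable m MeasureTheory.volume x y := fun x y hx hxA hy hyA =>
    (hc.mono (by intro z hz; exact ⟨(le_min hx hy).trans hz.1, hz.2.trans (max_le hxA hyA)⟩)
      ).intervalIntegrable
  have hsplit : ∀ x, 0 ≤ x → x ≤ A →
      ∫ t in (0 : ℝ)..x, m t = (∫ t in (0 : ℝ)..s, m t) + ∫ t in s..x, m t := fun x hx hxA =>
    (intervalIntegral.integral_add_adjacent_intervals
      (hint 0 s le_rfl (by linarith) (by linarith) (by linarith))
      (hint s x (by linarith) (by linarith) hx hxA)).symm
  have hineq : ∀ x ∈ Icc l u,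
      (s - (1 + r) * ∫ t in (0 : ℝ)..s, m t ≤ x - (1 + r) * ∫ t in (0 : ℝ)..x, m t) ↔
        ∫ t in s..x, m t ≤ (x - s) * (1 + r)⁻¹ := by
    intro x hx
    rw [hsplit x (by linarith [hx.1]) (by linarith [hx.2]), ← div_eq_mul_inv, le_div_iff₀ hr1]
    constructor <;> intro h <;> linarith
  have hb : ∀ x y, 0 ≤ x → x ≤ y → y ≤ A → (y - x) * m y ≤ ∫ t in x..y, m t ∧
      ∫ t in x..y, m t ≤ (y - x) * m x := fun x y hx hxy hy =>
    integral_le_of_antitoneOn hxy (hc.mono (Icc_subset_Icc hx hy)) (hm.mono (Icc_subset_Icc hx hy))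
  have hcs := Metric.continuousWithinAt_iff.1 (hc s ⟨by linarith, by linarith⟩)
  constructor
  · intro h
    constructor
    · intro hlt
      by_contra! hcon
      -- If the marginal price exceeds the threshold at `s`, it still does at a nearby point `y` to
      -- the right, and moving there lowers the cost. The other case is the mirror image.
      obtain ⟨d, hd, hd'⟩ := hcs (m s - (1 + r)⁻¹) (by linarith)
      set y := min u (s + d / 2) with hy
      have hsy : s < y := lt_min hlt (by linarith)
      have hyu : y ≤ u := min_le_left _ _
      have hyd : y ≤ s + d / 2 := min_le_right _ _
      have h1 := hd' (x := y) ⟨by linarith, by linarith⟩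
        (by rw [Real.dist_eq, abs_lt]; constructor <;> linarith)
      rw [Real.dist_eq, abs_lt] at h1
      have h2 := (hineq y ⟨by linarith, hyu⟩).1 (h y ⟨by linarith, hyu⟩)
      have h3 := (hb s y (by linarith) hsy.le (by linarith)).1
      have : (y - s) * (1 + r)⁻¹ < (y - s) * m y :=
        mul_lt_mul_of_pos_left (by linarith [h1.1]) (by linarith)
      linarith
    · intro hlt
      by_contra! hcon
      obtain ⟨d, hd, hd'⟩ := hcs ((1 + r)⁻¹ - m s) (by linarith)
      set y := max l (s - d / 2) with hy
      have hsy : y < s := max_lt hlt (by linarith)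
      have hyl : l ≤ y := le_max_left _ _
      have hyd : s - d / 2 ≤ y := le_max_right _ _
      have h1 := hd' (x := y) ⟨by linarith, by linarith⟩
        (by rw [Real.dist_eq, abs_lt]; constructor <;> linarith)
      rw [Real.dist_eq, abs_lt] at h1
      have h2 := (hineq y ⟨hyl, by linarith⟩).1 (h y ⟨hyl, by linarith⟩)
      have h3 := (hb y s (by linarith) hsy.le (by linarith)).2
      rw [intervalIntegral.integral_symm] at h2
      have : (s - y) * m y < (s - y) * (1 + r)⁻¹ :=
        mul_lt_mul_of_pos_left (by linarith [h1.2]) (by linarith)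
      linarith
  · rintro ⟨h1, h2⟩ x hx
    rw [hineq x hx]
    rcases lt_trichotomy x s with hxs | rfl | hxs
    · have h3 := (hb x s (by linarith [hx.1]) hxs.le (by linarith)).1
      have := mul_le_mul_of_nonneg_left (h2 (by linarith [hx.1])) (sub_nonneg.2 hxs.le)
      rw [intervalIntegral.integral_symm]
      linarith
    · simp
    · have h3 := (hb s x (by linarith) hxs.le (by linarith [hx.2])).2
      have := mul_le_mul_of_nonneg_left (h1 (by linarith [hx.2])) (sub_nonneg.2 hxs.le)
      linarith

/-! ### Equilibria via marginal prices -/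

/-- `marg i s` is the marginal price that bank `i` obtains for the last unit of its liquidations:
the revenue of bank `i` is the integral of its marginal prices, which decrease with its own
liquidations. -/
structure IsMarginalPrice {n : ℕ} (a : Fin n → ℝ) (fbar marg : Fin n → (Fin n → ℝ) → ℝ) :
    Prop where
  revenue_eq : ∀ s ∈ liquidationSet a, ∀ i, ∀ x ∈ Icc 0 (a i),
    x * fbar i (Function.update s i x) = ∫ t in (0 : ℝ)..x, marg i (Function.update s i t)
  continuousOn : ∀ s ∈ liquidationSet a, ∀ i,
    ContinuousOn (fun t => marg i (Function.update s i t)) (Icc 0 (a i))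
  antitoneOn : ∀ s ∈ liquidationSet a, ∀ i,
    AntitoneOn (fun t => marg i (Function.update s i t)) (Icc 0 (a i))

/-- First order conditions for an equilibrium in which every bank covers its shortfall. -/
structure IsFirstOrderEquilibrium {n : ℕ} (a h : Fin n → ℝ) (ρ : ℝ)
    (fbar marg : Fin n → (Fin n → ℝ) → ℝ) (g : ℝ → ℝ) (s : Fin n → ℝ) : Prop where
  mem : s ∈ liquidationSet a
  revenue_le : ∀ i, s i * fbar i s ≤ h i
  le_cash : ∀ i, h i ≤ s i * fbar i s + (a i - s i) * g (∑ j, s j)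
  marg_le : ∀ i, s i * fbar i s < h i → marg i s ≤ ρ
  le_marg : ∀ i, 0 < s i → h i < s i * fbar i s + (a i - s i) * g (∑ j, s j) → ρ ≤ marg i s

/-- The prices are those produced by `s` itself, so the bounds on `s i` become the revenue and cash
inequalities at `s`. Solvency makes the alternative of full liquidation vacuous and puts the upper
bound `h i / F` inside `[0, a i]`; `forall_cost_le_iff` does the rest. -/
theorem isClearing_iff {n : ℕ} {a h : Fin n → ℝ} {r : ℝ} (hr : 0 ≤ r) (hh : ∀ i, 0 < h i)
    {fbar marg : Fin n → (Fin n → ℝ) → ℝ} {g : ℝ → ℝ} (hmarg : IsMarginalPrice a fbar marg)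
    (hg : ∀ s ∈ liquidationSet a, 0 < g (∑ j, s j))
    (hgf : ∀ s ∈ liquidationSet a, ∀ i, g (∑ j, s j) < fbar i s)
    (hsolv : ∀ s ∈ liquidationSet a, ∀ i, h i ≤ a i * fbar i s) (p : ℝ × (Fin n → ℝ)) :
    IsClearing a h r fbar g p ↔
      ∃ s, IsFirstOrderEquilibrium a h (1 + r)⁻¹ fbar marg g s ∧
        p = (g (∑ j, s j), fun i => fbar i s) := by
  have key : ∀ s ∈ liquidationSet a,
      IsNashEquilibrium a h r fbar (g (∑ j, s j)) (fun i => fbar i s) s ↔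
        IsFirstOrderEquilibrium a h (1 + r)⁻¹ fbar marg g s := by
    intro s hs
    have hbank : ∀ i, ((h i ≤ a i * fbar i s →
          s i ∈ admissible a h (g (∑ j, s j)) (fun i => fbar i s) i ∧
            ∀ x ∈ admissible a h (g (∑ j, s j)) (fun i => fbar i s) i,
              cost r h fbar s i (s i) ≤ cost r h fbar s i x) ∧
       (a i * fbar i s < h i → s i = a i)) ↔
       (s i * fbar i s ≤ h i ∧ h i ≤ s i * fbar i s + (a i - s i) * g (∑ j, s j) ∧
        (s i * fbar i s < h i → marg i s ≤ (1 + r)⁻¹) ∧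
        (0 < s i → h i < s i * fbar i s + (a i - s i) * g (∑ j, s j) → (1 + r)⁻¹ ≤ marg i s)) := by
      intro i
      have hq := hg s hs
      have hqf := hgf s hs i
      have hso := hsolv s hs i
      have hsi := hs i
      have hhi := hh i
      set q := g (∑ j, s j) with hqdef
      set F := fbar i s with hF
      have hFpos : 0 < F := hq.trans hqf
      have hd : 0 < F - q := by linarith
      set l := max 0 ((h i - a i * q) / (F - q)) with hl
      set u := h i / F with hu
      have hua : u ≤ a i := by rw [hu, div_le_iff₀ hFpos]; exact hso
      have hadm : admissible a h q (fun i => fbar i s) i = Icc l u := by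
        ext x
        simp only [admissible, mem_ofPred_eq, mem_Icc, hl, sup_le_iff, ← hF, ← hu]
        constructor
        · rintro ⟨⟨h1, h2⟩, h3, h4⟩; exact ⟨⟨h1, h4⟩, h3⟩
        · rintro ⟨⟨h1, h4⟩, h3⟩; exact ⟨⟨h1, h3.trans hua⟩, h3, h4⟩
      have hcost : ∀ x ∈ Icc 0 (a i), cost r h fbar s i x =
          (x - (1 + r) * ∫ t in (0 : ℝ)..x, marg i (Function.update s i t)) + r * h i := by
        intro x hx
        rw [← hmarg.revenue_eq s hs i x hx, cost]; ring
      have hsu : s i ≤ u ↔ s i * F ≤ h i := by rw [hu, le_div_iff₀ hFpos]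
      have hsu' : s i < u ↔ s i * F < h i := by rw [hu, lt_div_iff₀ hFpos]
      have hls : l ≤ s i ↔ h i ≤ s i * F + (a i - s i) * q := by
        rw [hl, sup_le_iff, div_le_iff₀ hd]
        constructor
        · rintro ⟨-, h2⟩; linarith
        · intro h2; exact ⟨hsi.1, by linarith⟩
      have hls' : l < s i ↔ 0 < s i ∧ h i < s i * F + (a i - s i) * q := by
        rw [hl, max_lt_iff, div_lt_iff₀ hd]
        constructor
        · rintro ⟨h1, h2⟩; exact ⟨h1, by linarith⟩
        · rintro ⟨h1, h2⟩; exact ⟨h1, by linarith⟩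
      have hfoc : l ≤ s i → s i ≤ u →
          ((∀ x ∈ Icc l u, cost r h fbar s i (s i) ≤ cost r h fbar s i x) ↔
          (s i < u → marg i s ≤ (1 + r)⁻¹) ∧ (l < s i → (1 + r)⁻¹ ≤ marg i s)) := by
        intro h1 h2
        have := forall_cost_le_iff hr (hmarg.continuousOn s hs i) (hmarg.antitoneOn s hs i)
          (le_max_left 0 ((h i - a i * q) / (F - q))) h1 h2 hua
        rw [Function.update_eq_self] at this
        rw [← this]
        refine forall₂_congr fun x hx => ?_
        rw [hcost _ hsi, hcost x ⟨(le_max_left _ _).trans hx.1, hx.2.trans hua⟩,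
          add_le_add_iff_right]
      rw [hadm]
      constructor
      · rintro ⟨h1, -⟩
        obtain ⟨⟨h2, h3⟩, h4⟩ := h1 hso
        obtain ⟨h5, h6⟩ := (hfoc h2 h3).1 h4
        exact ⟨hsu.1 h3, hls.1 h2, fun h => h5 (hsu'.2 h), fun h h' => h6 (hls'.2 ⟨h, h'⟩)⟩
      · rintro ⟨h1, h2, h3, h4⟩
        refine ⟨fun _ => ⟨⟨hls.2 h2, hsu.2 h1⟩, (hfoc (hls.2 h2) (hsu.2 h1)).2
          ⟨fun h => h3 (hsu'.1 h), fun h => h4 (hls'.1 h).1 (hls'.1 h).2⟩⟩, fun h => ?_⟩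
        exact absurd h (not_lt.2 hso)
    constructor
    · intro h
      have := fun i => (hbank i).1 (h i)
      exact ⟨hs, fun i => (this i).1, fun i => (this i).2.1, fun i => (this i).2.2.1,
        fun i => (this i).2.2.2⟩
    · intro h i
      exact (hbank i).2 ⟨h.revenue_le i, h.le_cash i, h.marg_le i, h.le_marg i⟩
  constructor
  · rintro ⟨s, hs, hN, hp1, hp2⟩
    have hp : p = (g (∑ j, s j), fun i => fbar i s) := Prod.ext hp1 (funext hp2)
    subst hp
    exact ⟨s, (key s hs).1 hN, rfl⟩
  · rintro ⟨s, hs, rfl⟩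
    exact ⟨s, hs.mem, (key s hs.mem).2 hs, rfl, fun i => rfl⟩

/-! ### Regular densities -/

/-- An order book density extended to the real line, with the Lipschitz constant `K` on
`[0, M]`. -/
structure IsRegularDensity (M K : ℝ) (f : ℝ → ℝ) : Prop where
  continuous : Continuous f
  antitone : Antitone f
  pos : ∀ x, 0 < f x
  le_one : ∀ x, f x ≤ 1
  strictAnti : StrictAntiOn f (Icc 0 M)
  at_zero : f 0 = 1
  sub_le : ∀ x y, 0 ≤ x → x ≤ y → y ≤ M → f x - f y ≤ K * (y - x)

/-- The extension of `f` from `[0, M]` to the real line that is constant on both sides. -/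
noncomputable def clampExtend (M : ℝ) (f : ℝ → ℝ) (x : ℝ) : ℝ := f (max 0 (min x M))

theorem clampExtend_of_mem {M : ℝ} {f : ℝ → ℝ} {x : ℝ} (hx : x ∈ Icc 0 M) :
    clampExtend M f x = f x := by
  simp [clampExtend, min_eq_left hx.2, max_eq_right hx.1]

/-- As `f'` is nondecreasing, its most negative value is at `0`, so the mean value theorem gives the
Lipschitz constant `-f'(0)`. Clamping makes continuity, monotonicity and positivity global, so that
later integrals need no domain conditions. -/
theorem IsOrderBookDensity.isRegularDensity {M : ℝ} (hM : 0 < M) {f : ℝ → ℝ}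
    (hf : IsOrderBookDensity M f) :
    IsRegularDensity M (-derivWithin f (Icc 0 M) 0) (clampExtend M f) := by
  have hmem : ∀ x, max 0 (min x M) ∈ Icc 0 M := fun x =>
    ⟨le_max_left _ _, max_le hM.le (min_le_right _ _)⟩
  have hc := hf.contDiff.continuousOn
  have hd : DifferentiableOn ℝ f (Icc 0 M) := hf.contDiff.differentiableOn (by norm_num)
  refine ⟨?_, ?_, fun x => (hf.mapsTo (hmem x)).1, fun x => (hf.mapsTo (hmem x)).2, ?_, ?_, ?_⟩
  · exact hc.comp_continuous (by fun_prop) hmem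
  · intro x y hxy
    exact hf.strictAnti.antitoneOn (hmem x) (hmem y) (by gcongr)
  · intro x hx y hy hxy
    rw [clampExtend_of_mem hx, clampExtend_of_mem hy]
    exact hf.strictAnti hx hy hxy
  · rw [clampExtend_of_mem ⟨le_rfl, hM.le⟩, hf.at_zero]
  · intro x y hx hxy hy
    rw [clampExtend_of_mem ⟨hx, hxy.trans hy⟩, clampExtend_of_mem ⟨hx.trans hxy, hy⟩]
    rcases hxy.eq_or_lt with rfl | hlt
    · simp
    have hsub : Icc x y ⊆ Icc 0 M := Icc_subset_Icc hx hy
    obtain ⟨c, hcm, hc'⟩ := exists_deriv_eq_slope f hlt (hc.mono hsub)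
      (hd.mono (Ioo_subset_Icc_self.trans hsub))
    have hcI : c ∈ Icc 0 M := hsub (Ioo_subset_Icc_self hcm)
    have hnhds : Icc 0 M ∈ nhds c := Icc_mem_nhds (by linarith [hcm.1]) (by linarith [hcm.2])
    have h1 := hf.deriv_mono ⟨le_rfl, hM.le⟩ hcI hcI.1
    rw [derivWithin_of_mem_nhds hnhds, hc', le_div_iff₀ (by linarith)] at h1
    linarith

/-- Secant slopes of a convex function increase, so none lies below the one-sided derivative at `0`.
-/
theorem sub_le_of_convexOn {M : ℝ} (hM : 0 < M) {g : ℝ → ℝ} (hg : ConvexOn ℝ (Icc 0 M) g)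
    (hd : DifferentiableWithinAt ℝ g (Icc 0 M) 0) {x y : ℝ} (hx : 0 ≤ x) (hxy : x ≤ y)
    (hy : y ≤ M) : g x - g y ≤ -derivWithin g (Icc 0 M) 0 * (y - x) := by
  rcases hxy.eq_or_lt with rfl | hlt
  · simp
  have h0 : (0 : ℝ) ∈ Icc 0 M := ⟨le_rfl, hM.le⟩
  have hym : y ∈ Icc 0 M := ⟨hx.trans hxy, hy⟩
  have key : ∀ z ∈ Icc 0 M, 0 < z → derivWithin g (Icc 0 M) 0 ≤ slope g 0 z := fun z hz hz0 =>
    hg.derivWithin_le_slope h0 hz hz0 hd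
  have hsl : derivWithin g (Icc 0 M) 0 ≤ (g y - g x) / (y - x) := by
    rcases hx.eq_or_lt with rfl | hx0
    · have := key y hym hlt
      rwa [slope_def_field] at this
    · have h1 := key x ⟨hx, hxy.trans hy⟩ hx0
      rw [slope_def_field] at h1
      exact h1.trans (hg.slope_mono_adjacent h0 hym hx0 hlt)
  rw [le_div_iff₀ (by linarith)] at hsl
  linarith

/-- Averages over `[0, x]` of an antitone function decrease with `x`. -/
theorem mul_integral_le_mul_integral {m : ℝ → ℝ} (hc : Continuous m) (hm : Antitone m) {x y : ℝ}
    (hx : 0 ≤ x) (hxy : x ≤ y) :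
    x * ∫ t in (0 : ℝ)..y, m t ≤ y * ∫ t in (0 : ℝ)..x, m t := by
  have h1 := integral_le_of_antitoneOn hx hc.continuousOn (hm.antitoneOn _)
  have h2 := integral_le_of_antitoneOn hxy hc.continuousOn (hm.antitoneOn _)
  have h3 := intervalIntegral.integral_add_adjacent_intervals
    (hc.intervalIntegrable (μ := MeasureTheory.volume) 0 x) (hc.intervalIntegrable x y)
  have h4 := mul_le_mul_of_nonneg_left h1.1 (sub_nonneg.2 hxy)
  have h5 := mul_le_mul_of_nonneg_left h2.2 hx
  rw [← h3]
  nlinarith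


/-! ### Volume weighted average prices -/

/-- The volume weighted average price as a function of the total liquidations. -/
noncomputable def vwapAverage (f : ℝ → ℝ) (S : ℝ) : ℝ :=
  if S = 0 then 1 else (∫ σ in (0 : ℝ)..S, f σ) / S

/-- The marginal volume weighted average price of bank `i`. -/
noncomputable def vwapMarginal {n : ℕ} (f : ℝ → ℝ) (i : Fin n) (s : Fin n → ℝ) : ℝ :=
  if ∑ j, s j = 0 then 1
  else ((∑ j, s j - s i) * vwapAverage f (∑ j, s j) + s i * f (∑ j, s j)) / ∑ j, s j

theorem vwapPrice_eq {n : ℕ} (f : ℝ → ℝ) {s : Fin n → ℝ} (hs : ∀ i, 0 ≤ s i) :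
    vwapPrice f s = vwapAverage f (∑ j, s j) := by
  have : s = 0 ↔ ∑ j, s j = 0 := by
    rw [Finset.sum_eq_zero_iff_of_nonneg fun i _ => hs i, funext_iff]; simp
  simp only [vwapPrice, vwapAverage, this]

theorem mul_vwapAverage (f : ℝ → ℝ) (S : ℝ) : S * vwapAverage f S = ∫ σ in (0 : ℝ)..S, f σ := by
  by_cases h : S = 0
  · simp [h]
  · rw [vwapAverage, if_neg h, mul_div_cancel₀ _ h]

theorem vwapAverage_of_ne (f : ℝ → ℝ) {S : ℝ} (h : S ≠ 0) :
    vwapAverage f S = (∫ σ in (0 : ℝ)..S, f σ) / S := if_neg h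

theorem vwapAverage_zero (f : ℝ → ℝ) : vwapAverage f 0 = 1 := if_pos rfl

namespace IsRegularDensity

variable {M K : ℝ} {f : ℝ → ℝ}

theorem nonneg_of_pos (hf : IsRegularDensity M K f) (hM : 0 < M) : 0 ≤ K := by
  have h1 := hf.sub_le 0 M le_rfl hM.le le_rfl
  have h2 := hf.antitone hM.le
  nlinarith

theorem integral_lt (hf : IsRegularDensity M K f) {x y : ℝ} (hx : 0 ≤ x) (hxy : x < y)
    (hy : y ≤ M) : (y - x) * f y < ∫ t in x..y, f t ∧ ∫ t in x..y, f t < (y - x) * f x := by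
  have hc := hf.continuous
  set z := (x + y) / 2 with hz
  have hxz : x < z := by linarith
  have hzy : z < y := by linarith
  have h1 := integral_le_of_antitoneOn hxz.le hc.continuousOn (hf.antitone.antitoneOn _)
  have h2 := integral_le_of_antitoneOn hzy.le hc.continuousOn (hf.antitone.antitoneOn _)
  have h3 := intervalIntegral.integral_add_adjacent_intervals
    (hc.intervalIntegrable (μ := MeasureTheory.volume) x z) (hc.intervalIntegrable z y)
  have h4 : f z < f x := hf.strictAnti ⟨hx, by linarith⟩ ⟨by linarith, by linarith⟩ hxz
  have h5 : f y < f z := hf.strictAnti ⟨by linarith, by linarith⟩ ⟨by linarith, by linarith⟩ hzy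
  have e1 : z - x = (y - x) / 2 := by rw [hz]; ring
  have e2 : y - z = (y - x) / 2 := by rw [hz]; ring
  rw [← h3]
  rw [e1] at h1
  rw [e2] at h2
  constructor <;> nlinarith

theorem vwapAverage_antitone (hf : IsRegularDensity M K f) {S S' : ℝ} (hS : 0 ≤ S)
    (hSS : S ≤ S') : vwapAverage f S' ≤ vwapAverage f S := by
  rcases hS.eq_or_lt with rfl | hS0
  · rcases hSS.eq_or_lt with rfl | hS'
    · exact le_rfl
    · have := (integral_le_of_antitoneOn hSS hf.continuous.continuousOn
        (hf.antitone.antitoneOn _)).2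
      rw [vwapAverage_zero, vwapAverage_of_ne f hS'.ne', div_le_one hS']
      simpa [hf.at_zero] using this
  · have := mul_integral_le_mul_integral hf.continuous hf.antitone hS hSS
    rw [vwapAverage_of_ne f hS0.ne', vwapAverage_of_ne f (hS0.trans_le hSS).ne',
      div_le_div_iff₀ (hS0.trans_le hSS) hS0]
    linarith

theorem vwapAverage_le_one (hf : IsRegularDensity M K f) {S : ℝ} (hS : 0 ≤ S) :
    vwapAverage f S ≤ 1 := by
  simpa [vwapAverage_zero] using hf.vwapAverage_antitone le_rfl hS

theorem le_vwapAverage (hf : IsRegularDensity M K f) {S : ℝ} (hS : 0 ≤ S) :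
    f S ≤ vwapAverage f S := by
  rcases hS.eq_or_lt with rfl | hS0
  · rw [vwapAverage_zero, hf.at_zero]
  · have := (integral_le_of_antitoneOn hS hf.continuous.continuousOn
        (hf.antitone.antitoneOn _)).1
    rw [vwapAverage_of_ne f hS0.ne', le_div_iff₀ hS0]
    linarith

theorem lt_vwapAverage (hf : IsRegularDensity M K f) {S : ℝ} (hS : 0 < S) (hSM : S ≤ M) :
    f S < vwapAverage f S := by
  have := (hf.integral_lt le_rfl hS hSM).1
  rw [vwapAverage_of_ne f hS.ne', lt_div_iff₀ hS]
  linarith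

theorem vwapAverage_pos (hf : IsRegularDensity M K f) {S : ℝ} (hS : 0 ≤ S) :
    0 < vwapAverage f S := (hf.pos S).trans_le (hf.le_vwapAverage hS)

/-- The average over `[0, S']` mixes the average over `[0, S]` with values at least `f S'`. This
gives `S' (F - F') ≤ (S' - S)(1 - f S')`, and `1 - f S' ≤ K S'` cancels the factor `S'`. -/
theorem vwapAverage_sub_le (hf : IsRegularDensity M K f) {S S' : ℝ} (hS : 0 ≤ S) (hSS : S ≤ S')
    (hM : S' ≤ M) : vwapAverage f S - vwapAverage f S' ≤ K * (S' - S) := by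
  rcases (hS.trans hSS).eq_or_lt with h0 | hS'
  · have : S = S' := by linarith
    simp [this]
  have h1 := (integral_le_of_antitoneOn hSS hf.continuous.continuousOn
        (hf.antitone.antitoneOn _)).1
  have h2 := intervalIntegral.integral_add_adjacent_intervals
    (hf.continuous.intervalIntegrable (μ := MeasureTheory.volume) 0 S)
    (hf.continuous.intervalIntegrable S S')
  rw [← mul_vwapAverage, ← mul_vwapAverage] at h2
  have h3 := hf.sub_le 0 S' le_rfl hS'.le hM
  rw [hf.at_zero] at h3
  have h4 := hf.vwapAverage_le_one hS
  have h5 : S' * (vwapAverage f S - vwapAverage f S') ≤ S' * (K * (S' - S)) := by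
    nlinarith [mul_nonneg (sub_nonneg.2 hSS) (sub_nonneg.2 h4),
      mul_nonneg (sub_nonneg.2 hSS) (sub_nonneg.2 h3)]
  exact le_of_mul_le_mul_left h5 hS'

theorem continuousOn_vwapAverage (hf : IsRegularDensity M K f) (hM : 0 < M) :
    ContinuousOn (vwapAverage f) (Icc 0 M) := by
  refine (LipschitzOnWith.of_dist_le_mul (K := ⟨K, hf.nonneg_of_pos hM⟩) ?_).continuousOn
  have key : ∀ x ∈ Icc 0 M, ∀ y ∈ Icc 0 M, x ≤ y →
      dist (vwapAverage f x) (vwapAverage f y) ≤ K * dist x y := by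
    intro x hx y hy hxy
    rw [Real.dist_eq, Real.dist_eq, abs_of_nonneg (sub_nonneg.2 (hf.vwapAverage_antitone hx.1 hxy)),
      abs_sub_comm, abs_of_nonneg (sub_nonneg.2 hxy)]
    exact hf.vwapAverage_sub_le hx.1 hxy hy.2
  intro x hx y hy
  rcases le_total x y with h | h
  · exact key x hx y hy h
  · rw [dist_comm, dist_comm x y]; exact key y hy x hx h

end IsRegularDensity

theorem sum_update_eq {n : ℕ} (s : Fin n → ℝ) (i : Fin n) (t : ℝ) :
    ∑ j, Function.update s i t j = t + ∑ j ∈ Finset.univ \ {i}, s j :=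
  Finset.sum_update_of_mem (Finset.mem_univ i) s t

theorem update_mem_liquidationSet {n : ℕ} {a s : Fin n → ℝ} (hs : s ∈ liquidationSet a) (i : Fin n)
    {t : ℝ} (ht : t ∈ Icc 0 (a i)) : Function.update s i t ∈ liquidationSet a := by
  intro j
  rcases eq_or_ne j i with rfl | h
  · simpa using ht
  · simpa [h] using hs j

/-- With `T` the sales of the others, differentiating `t F(t + T)` gives the mean of `F` and `f`
with weights `T` and `t`. It decreases because both functions do and the weight moves towards the
smaller one, `f`. For `T = 0` it is `f` itself, with the convention at zero matching `f 0 = 1`. -/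
theorem IsRegularDensity.isMarginalPrice_vwap {M K : ℝ} {f : ℝ → ℝ} (hf : IsRegularDensity M K f)
    {n : ℕ} (a : Fin n → ℝ) :
    IsMarginalPrice a (fun _ => vwapPrice f) (vwapMarginal f) := by
  have main : ∀ T : ℝ, 0 ≤ T → ∀ m : ℝ → ℝ,
      (∀ t, m t = if t + T = 0 then 1
        else (T * vwapAverage f (t + T) + t * f (t + T)) / (t + T)) →
      (∀ x, 0 ≤ x → x * vwapAverage f (x + T) = ∫ t in (0 : ℝ)..x, m t) ∧
        ContinuousOn m (Ici 0) ∧ AntitoneOn m (Ici 0) := by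
    intro T hT m hm
    rcases hT.eq_or_lt with rfl | hT
    · have hmf : EqOn m f (Ici 0) := by
        intro t ht
        rcases (mem_Ici.1 ht).eq_or_lt with rfl | h
        · simp [hm, hf.at_zero]
        · simp only [hm, add_zero, if_neg h.ne', zero_mul, zero_add]
          field_simp
      refine ⟨fun x hx => ?_, hf.continuous.continuousOn.congr hmf,
        (hf.antitone.antitoneOn _).congr hmf.symm⟩
      rw [add_zero, mul_vwapAverage]
      refine intervalIntegral.integral_congr fun t ht => ?_
      rw [uIcc_of_le hx] at ht
      exact (hmf ht.1).symm
    · have hpos : ∀ t ∈ Ici (0 : ℝ), t + T ≠ 0 := fun t ht => by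
        have : 0 ≤ t := ht
        positivity
      have hm' : ∀ t ∈ Ici (0 : ℝ), m t =
          (T * ((∫ σ in (0 : ℝ)..(t + T), f σ) / (t + T)) + t * f (t + T)) / (t + T) := by
        intro t ht
        rw [hm, if_neg (hpos t ht), vwapAverage_of_ne f (hpos t ht)]
      have hP : ∀ x, HasDerivAt (fun x => ∫ σ in (0 : ℝ)..x, f σ) (f x) x := fun x =>
        (hf.continuous.integral_hasStrictDerivAt 0 x).hasDerivAt
      have hPc : Continuous fun x => ∫ σ in (0 : ℝ)..x, f σ :=
        continuous_iff_continuousAt.2 fun x => (hP x).continuousAt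
      have hcont : ContinuousOn m (Ici 0) := by
        refine ContinuousOn.congr ?_ hm'
        have h1 : Continuous fun t => ∫ σ in (0 : ℝ)..(t + T), f σ :=
          hPc.comp (continuous_add_const T)
        have h2 : Continuous fun t => f (t + T) := hf.continuous.comp (continuous_add_const T)
        refine ContinuousOn.div (ContinuousOn.add (continuousOn_const.mul
          (h1.continuousOn.div (by fun_prop) hpos)) (continuousOn_id.mul h2.continuousOn))
          (by fun_prop) hpos
      refine ⟨fun x hx => ?_, hcont, ?_⟩
      · have hd : ∀ t ∈ uIcc 0 x,
            HasDerivAt (fun t => t * ((∫ σ in (0 : ℝ)..(t + T), f σ) / (t + T))) (m t) t := by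
          intro t ht
          rw [uIcc_of_le hx] at ht
          have h0 := hpos t ht.1
          have h1 : HasDerivAt (fun t => t + T) 1 t := (hasDerivAt_id t).add_const T
          have h2 : HasDerivAt (fun t => ∫ σ in (0 : ℝ)..(t + T), f σ) (f (t + T)) t := 
            (hP (t + T)).comp_add_const t T
          have h3 := (hasDerivAt_id' t).mul (h2.div h1 h0)
          refine HasDerivAt.congr_deriv h3 ?_
          rw [hm' t ht.1]
          simp only [Pi.div_apply]
          field_simp
          ring
        rw [intervalIntegral.integral_eq_sub_of_hasDerivAt hd
          (hcont.mono (by rw [uIcc_of_le hx]; exact Icc_subset_Ici_self)).intervalIntegrable,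
          vwapAverage_of_ne f (hpos x hx)]
        simp
      · intro t ht t' ht' htt
        have ht0 : 0 ≤ t := ht
        have h1 : 0 < t + T := by linarith
        have h2 : 0 < t' + T := by linarith
        rw [hm, hm, if_neg h1.ne', if_neg h2.ne', div_le_div_iff₀ h2 h1]
        have h3 := hf.vwapAverage_antitone h1.le (by linarith : t + T ≤ t' + T)
        have h4 := hf.antitone (by linarith : t + T ≤ t' + T)
        have h5 := hf.le_vwapAverage h1.le
        have e1 := mul_nonneg (mul_nonneg hT.le h1.le) (sub_nonneg.2 h3)
        have e2 := mul_nonneg (mul_nonneg (ht0.trans htt) h1.le) (sub_nonneg.2 h4)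
        have e3 := mul_nonneg (mul_nonneg hT.le (sub_nonneg.2 htt)) (sub_nonneg.2 h5)
        linarith
  have hmain : ∀ s ∈ liquidationSet a, ∀ i, 0 ≤ ∑ j ∈ Finset.univ \ {i}, s j ∧
      ∀ t, vwapMarginal f i (Function.update s i t) =
      if t + ∑ j ∈ Finset.univ \ {i}, s j = 0 then 1
        else ((∑ j ∈ Finset.univ \ {i}, s j) * vwapAverage f (t + ∑ j ∈ Finset.univ \ {i}, s j)
          + t * f (t + ∑ j ∈ Finset.univ \ {i}, s j)) / (t + ∑ j ∈ Finset.univ \ {i}, s j) := by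
    intro s hs i
    refine ⟨Finset.sum_nonneg fun j _ => (hs j).1, fun t => ?_⟩
    rw [vwapMarginal, sum_update_eq, Function.update_self, add_sub_cancel_left]
  refine ⟨fun s hs i x hx => ?_, fun s hs i => ?_, fun s hs i => ?_⟩
  · rw [vwapPrice_eq f fun j => (update_mem_liquidationSet hs i hx j).1, sum_update_eq]
    exact (main _ (hmain s hs i).1 _ (hmain s hs i).2).1 x hx.1
  · exact (main _ (hmain s hs i).1 _ (hmain s hs i).2).2.1.mono Icc_subset_Ici_self
  · exact (main _ (hmain s hs i).1 _ (hmain s hs i).2).2.2.mono Icc_subset_Ici_self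

/-! ### Uniqueness for volume weighted average prices -/

/-- If the total liquidations grow from `S` to `S'`, the liquidations at which the marginal price
equals `ρ` grow less than quadratically in the total. -/
theorem IsRegularDensity.vwap_scaling {M K : ℝ} {f : ℝ → ℝ} (hf : IsRegularDensity M K f)
    {S S' x x' ρ : ℝ} (hS : 0 < S) (hSS : S < S') (hS' : S' ≤ M) (hx' : 0 ≤ x')
    (h : (S - x) * vwapAverage f S + x * f S ≤ ρ * S)
    (h' : ρ * S' ≤ (S' - x') * vwapAverage f S' + x' * f S') :
    (x' - S') * S ^ 2 < (x - S) * S' ^ 2 := by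
  have hS'0 := hS.trans hSS
  have hf1 : f S' < f S := hf.strictAnti ⟨hS.le, by linarith⟩ ⟨by linarith, hS'⟩ hSS
  have hE0 := (hf.integral_lt le_rfl hS (by linarith)).1
  have hE0' := (hf.integral_lt le_rfl hS'0 hS').1
  have hPP := (hf.integral_lt hS.le hSS hS').1
  have hPP' := (hf.integral_lt hS.le hSS hS').2
  have hadd := intervalIntegral.integral_add_adjacent_intervals
    (hf.continuous.intervalIntegrable (μ := MeasureTheory.volume) 0 S)
    (hf.continuous.intervalIntegrable S S')
  have e1 := mul_vwapAverage f S
  have e2 := mul_vwapAverage f S'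
  set P := ∫ t in (0 : ℝ)..S, f t
  set P' := ∫ t in (0 : ℝ)..S', f t
  set F := vwapAverage f S
  set F' := vwapAverage f S'
  -- In terms of `E = S (F - f S)` the two marginal conditions become `k1` and `k2`; it remains to
  -- see that `(f - ρ) / E` strictly decreases with the total.
  set E := P - S * f S with hE
  set E' := P' - S' * f S' with hE'
  have hEpos : 0 < E := by linarith
  have hEpos' : 0 < E' := by linarith
  have hEE : E < E' := by nlinarith
  have k1 : S ^ 2 * (f S - ρ) ≤ (x - S) * E := by
    have := mul_le_mul_of_nonneg_left h hS.le
    have : S * ((S - x) * F + x * f S) = (S - x) * P + S * (x * f S) := by rw [← e1]; ring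
    nlinarith
  have k2 : (x' - S') * E' ≤ S' ^ 2 * (f S' - ρ) := by
    have := mul_le_mul_of_nonneg_left h' hS'0.le
    have : S' * ((S' - x') * F' + x' * f S') = (S' - x') * P' + S' * (x' * f S') := by
      rw [← e2]; ring
    nlinarith
  have k3 : 0 ≤ P' - ρ * S' := by
    have : 0 ≤ S' * (P' - ρ * S') := by nlinarith [mul_nonneg hx' hEpos'.le]
    exact nonneg_of_mul_nonneg_right this hS'0
  -- For `ρ ≤ f S'` the numerator drops while `E` grows. Otherwise the difference of the two sides
  -- is exactly `(ρ - f S')((S' - S) f S - (P' - P)) + (f S - f S')(P' - ρ S')`.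
  have key : (f S' - ρ) * E < (f S - ρ) * E' := by
    rcases le_or_gt ρ (f S') with hρ | hρ
    · nlinarith [mul_nonneg (sub_nonneg.2 hρ) (sub_nonneg.2 hEE.le),
        mul_pos (sub_pos.2 hf1) hEpos']
    · have h1 : P' - P < (S' - S) * f S := by linarith
      nlinarith [mul_pos (sub_pos.2 hρ) (sub_pos.2 h1), mul_nonneg (sub_nonneg.2 hf1.le) k3]
  have hS2 : 0 < S ^ 2 := by positivity
  have hS2' : 0 < S' ^ 2 := by positivity
  have l1 := mul_le_mul_of_nonneg_left k2 (mul_pos hS2 hEpos).le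
  have l2 := mul_le_mul_of_nonneg_left k1 (mul_pos hS2' hEpos').le
  have l3 := mul_lt_mul_of_pos_left key (mul_pos hS2 hS2')
  have : (E * E') * ((x' - S') * S ^ 2) < (E * E') * ((x - S) * S' ^ 2) := by linarith
  exact lt_of_mul_lt_mul_left this (mul_pos hEpos hEpos').le

/-- Replacing `x'` by the smaller `x` turns the scaling inequality into `S S' < x (S + S')`, which
fails for `x ≤ S / 2`. Hence at most one bank can be in this situation. -/
theorem two_mul_lt_of_scaling {S S' x x' : ℝ} (hS : 0 < S) (hSS : S < S') (hxx : x < x')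
    (h : (x' - S') * S ^ 2 < (x - S) * S' ^ 2) : S < 2 * x := by
  by_contra! hcon
  have l1 : x * S ^ 2 < x' * S ^ 2 := mul_lt_mul_of_pos_right hxx (by positivity)
  have l2 : (S' - S) * (S * S') < (S' - S) * (x * (S + S')) := by linarith
  have l3 := lt_of_mul_lt_mul_left l2 (by linarith)
  nlinarith

/-- The scaling inequality reads `(x'/S' - 1)/S' < (x/S - 1)/S`. As `x/S - 1 ≤ 0` and `S < S'`, the
share of the bank shrinks. -/
theorem mul_lt_of_scaling {S S' x x' : ℝ} (hS : 0 < S) (hSS : S < S') (hx : x ≤ S)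
    (h : (x' - S') * S ^ 2 < (x - S) * S' ^ 2) : x' * S < x * S' := by
  have l1 := mul_nonneg (mul_nonneg (hS.trans hSS).le (sub_nonneg.2 hSS.le)) (sub_nonneg.2 hx)
  have l2 : S * (x' * S) < S * (x * S') := by linarith
  exact lt_of_mul_lt_mul_left l2 hS.le

/-- A bank that already covers its shortfall by sales can sell more only to make up for the price
drop on `x`. -/
theorem increment_le_of_revenue_eq {a h x x' F F' q' μ d : ℝ} (hx : 0 ≤ x) (hxa : x ≤ a)
    (hxx : x ≤ x') (hμd : 0 ≤ μ * d) (hq : 0 ≤ q') (hF : F - F' ≤ μ * d) (h1 : x * F = h)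
    (h2 : x' * F' ≤ h) : (x' - x) * (F' - q') ≤ a * (μ * d) := by
  have e1 := mul_le_mul_of_nonneg_left hF hx
  have e2 := mul_le_mul_of_nonneg_right hxa hμd
  have e3 := mul_nonneg (sub_nonneg.2 hxx) hq
  linarith

/-- A bank whose cash constraint binds after the change sells more only to make up for the drop in
price on `x` and in haircut value on `a - x`. -/
theorem increment_le_of_cash_eq {a h x x' F F' q q' μ d : ℝ} (hx : 0 ≤ x) (hxa : x ≤ a)
    (hF : F - F' ≤ μ * d) (hq : q - q' ≤ μ * d) (h1 : h ≤ x * F + (a - x) * q)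
    (h2 : h = x' * F' + (a - x') * q') : (x' - x) * (F' - q') ≤ a * (μ * d) := by
  have e1 := mul_le_mul_of_nonneg_left hF hx
  have e2 := mul_le_mul_of_nonneg_left hq (sub_nonneg.2 hxa)
  linarith

theorem IsRegularDensity.not_vwap_lt {M K : ℝ} {f : ℝ → ℝ} (hf : IsRegularDensity M K f)
    {n : ℕ} {a h : Fin n → ℝ} (hM : ∑ i, a i ≤ M)
    {ρ μ : ℝ} (hρ : ρ ≤ 1) {g : ℝ → ℝ} (hμ0 : 0 ≤ μ) (hKμ : K ≤ μ)
    (hgpos : ∀ S ∈ Icc 0 M, 0 < g S) (hganti : AntitoneOn g (Icc 0 M))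
    (hgsub : ∀ x y, 0 ≤ x → x ≤ y → y ≤ M → g x - g y ≤ μ * (y - x))
    (hsmall : ∀ s ∈ liquidationSet a, M * μ < vwapAverage f (∑ j, s j) - g (∑ j, s j))
    {s s' : Fin n → ℝ}
    (hs : IsFirstOrderEquilibrium a h ρ (fun _ => vwapPrice f) (vwapMarginal f) g s)
    (hs' : IsFirstOrderEquilibrium a h ρ (fun _ => vwapPrice f) (vwapMarginal f) g s') :
    ¬ ∑ j, s j < ∑ j, s' j := by
  intro hlt
  have hpr := vwapPrice_eq f fun i => (hs.mem i).1
  have hpr' := vwapPrice_eq f fun i => (hs'.mem i).1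
  have hS0 : 0 ≤ ∑ j, s j := Finset.sum_nonneg fun i _ => (hs.mem i).1
  have hSM : ∑ j, s' j ≤ M := (Finset.sum_le_sum fun i _ => (hs'.mem i).2).trans hM
  have hle : ∀ i, s i ≤ ∑ j, s j := fun i =>
    Finset.single_le_sum (fun j _ => (hs.mem j).1) (Finset.mem_univ i)
  have hle' : ∀ i, s' i ≤ ∑ j, s' j := fun i =>
    Finset.single_le_sum (fun j _ => (hs'.mem j).1) (Finset.mem_univ i)
  have hsm := hsmall s' hs'.mem
  have hR := hs.revenue_le
  have hR' := hs'.revenue_le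
  have hC := hs.le_cash
  have hC' := hs'.le_cash
  have hm := hs.marg_le
  have hm' := hs'.le_marg
  simp only [vwapMarginal, hpr, hpr'] at hR hR' hC hC' hm hm'
  set S := ∑ j, s j with hS
  set S' := ∑ j, s' j with hS'
  have hS'0 : 0 < S' := hS0.trans_lt hlt
  have hF := hf.vwapAverage_antitone hS0 hlt.le
  have hFsub : vwapAverage f S - vwapAverage f S' ≤ μ * (S' - S) :=
    (hf.vwapAverage_sub_le hS0 hlt.le hSM).trans
      (mul_le_mul_of_nonneg_right hKμ (sub_nonneg.2 hlt.le))
  have hgs := hgsub S S' hS0 hlt.le hSM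
  have hq' := hgpos S' ⟨hS'0.le, hSM⟩
  have hqq := hganti ⟨hS0, hlt.le.trans hSM⟩ ⟨hS'0.le, hSM⟩ hlt.le
  have hFpos := hf.vwapAverage_pos hS'0.le
  -- Either the increment is controlled, or the bank grows with no binding constraint, in which case
  -- its marginal price is at most `ρ` at `s` and at least `ρ` at `s'`.
  have hdich : ∀ i, (s' i - s i) * (vwapAverage f S' - g S') ≤ a i * (μ * (S' - S)) ∨
      (s i < s' i ∧ s i * vwapAverage f S < h i ∧
        h i < s' i * vwapAverage f S' + (a i - s' i) * g S') := by
    intro i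
    have hsi := hs.mem i
    have hsi' := hs'.mem i
    have hai : 0 ≤ a i := hsi.1.trans hsi.2
    have hD : 0 ≤ vwapAverage f S' - g S' := by
      have : 0 ≤ M * μ := mul_nonneg (hS'0.le.trans hSM) hμ0
      linarith
    rcases le_or_gt (s' i) (s i) with h1 | h1
    · left
      exact (mul_nonpos_of_nonpos_of_nonneg (sub_nonpos.2 h1) hD).trans
        (mul_nonneg hai (mul_nonneg hμ0 (sub_nonneg.2 hlt.le)))
    rcases (hR i).eq_or_lt with h2 | h2
    · left
      exact increment_le_of_revenue_eq hsi.1 hsi.2 h1.le (mul_nonneg hμ0 (sub_nonneg.2 hlt.le))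
        hq'.le hFsub h2 (hR' i)
    rcases (hC' i).eq_or_lt with h3 | h3
    · left
      exact increment_le_of_cash_eq hsi.1 hsi.2 hFsub hgs (hC i) h3
    · exact Or.inr ⟨h1, h2, h3⟩
  by_cases hd : ∀ i, (s' i - s i) * (vwapAverage f S' - g S') ≤ a i * (μ * (S' - S))
  · have := Finset.sum_le_sum fun i (_ : i ∈ Finset.univ) => hd i
    rw [← Finset.sum_mul, ← Finset.sum_mul, Finset.sum_sub_distrib, ← hS, ← hS'] at this
    have h1 := mul_le_mul_of_nonneg_right hM (mul_nonneg hμ0 (sub_nonneg.2 hlt.le))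
    have h2 := mul_lt_mul_of_pos_right hsm (sub_pos.2 hlt)
    linarith
  · push Not at hd
    obtain ⟨i, hi⟩ := hd
    obtain ⟨h1, h2, h3⟩ := (hdich i).resolve_left (not_le.2 hi)
    have hsi := hs.mem i
    have hm1 := hm i h2
    have hm2 := hm' i (hsi.1.trans_lt h1) h3
    rw [if_neg hS'0.ne', le_div_iff₀ hS'0] at hm2
    rcases hS0.eq_or_lt with hS00 | hS00
    · rw [if_pos hS00.symm] at hm1
      have hfS : f S' < 1 := by
        rw [← hf.at_zero]
        exact hf.strictAnti ⟨le_rfl, hS'0.le.trans hSM⟩ ⟨hS'0.le, hSM⟩ hS'0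
      have hFS := hf.vwapAverage_le_one hS'0.le
      have hle'i := hle' i
      nlinarith [mul_nonneg (sub_nonneg.2 hle'i) (sub_nonneg.2 hFS),
        mul_pos (hsi.1.trans_lt h1) (sub_pos.2 hfS)]
    -- The marginal price depends only on the total and on own sales, so bank `j` at `s` may be
    -- compared with the different bank `i` at `s'`.
    have hlow : ∀ j, s j < s' i → s j * vwapAverage f S < h j → S < 2 * s j := by
      intro j hj hjh
      have hmj := hm j hjh
      rw [if_neg hS00.ne', div_le_iff₀ hS00] at hmj
      exact two_mul_lt_of_scaling hS00 hlt hj (hf.vwap_scaling hS00 hlt hSM (hs'.mem i).1 hmj hm2)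
    have hscale : s' i * S < s i * S' := by
      have hmi := hm1
      rw [if_neg hS00.ne', div_le_iff₀ hS00] at hmi
      exact mul_lt_of_scaling hS00 hlt (hle i) (hf.vwap_scaling hS00 hlt hSM (hs'.mem i).1 hmi hm2)
    have hi2 := hlow i h1 h2
    have hall : ∀ j, s' j * S ≤ s j * S' := by
      intro j
      rcases eq_or_ne j i with rfl | hji
      · exact hscale.le
      have hpair : s j + s i ≤ S := by
        have := Finset.sum_le_sum_of_subset_of_nonneg (Finset.subset_univ {j, i})
          (fun k _ _ => (hs.mem k).1)
        rwa [Finset.sum_pair hji] at this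
      -- Bank `i` holds more than half of `S`, so bank `j` holds less than half; by `hlow` it cannot
      -- be short of its target.
      have hjeq : s j * vwapAverage f S = h j := by
        refine (hR j).eq_of_not_lt fun hlt' => ?_
        have := hlow j (by linarith) hlt'
        linarith
      have hP := mul_vwapAverage f S
      have hP' := mul_vwapAverage f S'
      -- Total revenue grows with the total sold, so a bank whose own revenue does not grow cannot
      -- gain share of the total.
      have hPP : S * vwapAverage f S ≤ S' * vwapAverage f S' := by
        rw [hP, hP', ← intervalIntegral.integral_add_adjacent_intervals
          (hf.continuous.intervalIntegrable (μ := MeasureTheory.volume) 0 S)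
          (hf.continuous.intervalIntegrable S S')]
        have := (integral_le_of_antitoneOn hlt.le hf.continuous.continuousOn
          (hf.antitone.antitoneOn _)).1
        nlinarith [mul_pos (sub_pos.2 hlt) (hf.pos S')]
      have l1 : s' j * vwapAverage f S' * (S * S') ≤ s j * vwapAverage f S * (S * S') :=
        mul_le_mul_of_nonneg_right ((hR' j).trans hjeq.ge) (mul_pos hS00 hS'0).le
      have l2 := mul_le_mul_of_nonneg_left hPP (mul_nonneg (hs.mem j).1 hS'0.le)
      have l3 : (S' * vwapAverage f S') * (s' j * S) ≤ (S' * vwapAverage f S') * (s j * S') := by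
        linarith
      exact le_of_mul_le_mul_left l3 (mul_pos hS'0 hFpos)
    have := Finset.sum_lt_sum (fun j _ => hall j) ⟨i, Finset.mem_univ i, hscale⟩
    rw [← Finset.sum_mul, ← Finset.sum_mul, ← hS, ← hS'] at this
    linarith

/-! ### Existence for volume weighted average prices -/

theorem exists_clamp_sum_eq {n : ℕ} {a : Fin n → ℝ} {e : ℝ} (he : e ≤ ∑ i, a i) {c : ℝ → ℝ}
    {l u : Fin n → ℝ → ℝ} (hc : ContinuousOn c (Icc e (∑ i, a i)))
    (hl : ∀ i, ContinuousOn (l i) (Icc e (∑ i, a i)))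
    (hu : ∀ i, ContinuousOn (u i) (Icc e (∑ i, a i)))
    (hla : ∀ i, l i (∑ j, a j) ≤ a i) (hua : ∀ i, u i (∑ j, a j) ≤ a i)
    (hstart : e ≤ ∑ i, max (l i e) (min (c e) (u i e))) :
    ∃ S ∈ Icc e (∑ i, a i), ∑ i, max (l i S) (min (c S) (u i S)) = S := by
  have hcont : ContinuousOn (fun S => (∑ i, max (l i S) (min (c S) (u i S))) - S)
      (Icc e (∑ i, a i)) :=
    (continuousOn_finsetSum _ fun i _ => (hl i).sup (hc.inf (hu i))).sub continuousOn_id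
  have hend : ∑ i, max (l i (∑ j, a j)) (min (c (∑ j, a j)) (u i (∑ j, a j))) ≤ ∑ i, a i :=
    Finset.sum_le_sum fun i _ => max_le (hla i) ((min_le_right _ _).trans (hua i))
  obtain ⟨S, hS, h0⟩ := intermediate_value_Icc' he hcont
    (show (0 : ℝ) ∈ Icc _ _ from ⟨sub_nonpos.2 hend, sub_nonneg.2 hstart⟩)
  exact ⟨S, hS, sub_eq_zero.1 h0⟩

theorem IsRegularDensity.exists_vwap {M K : ℝ} {f : ℝ → ℝ} (hf : IsRegularDensity M K f)
    {n : ℕ} (hn : 0 < n) {a h : Fin n → ℝ} (ha : ∀ i, 0 < a i) (hh : ∀ i, 0 < h i)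
    (hM : ∑ i, a i ≤ M) {ρ : ℝ} (hρ : ρ ≤ 1) {g : ℝ → ℝ}
    (hgpos : ∀ S ∈ Icc 0 M, 0 < g S) (hgc : ContinuousOn g (Icc 0 M))
    (hgf : ∀ S ∈ Icc 0 (∑ i, a i), g S < vwapAverage f S)
    (hsolv : ∀ i, h i ≤ a i * vwapAverage f (∑ j, a j)) :
    ∃ s, IsFirstOrderEquilibrium a h ρ (fun _ => vwapPrice f) (vwapMarginal f) g s := by
  have : Nonempty (Fin n) := ⟨⟨0, hn⟩⟩
  have hA : 0 < ∑ i, a i := Finset.sum_pos (fun i _ => ha i) Finset.univ_nonempty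
  have hsub : Icc 0 (∑ i, a i) ⊆ Icc 0 M := Icc_subset_Icc_right hM
  have hFc := (hf.continuousOn_vwapAverage (hA.trans_le hM)).mono hsub
  have hgc' := hgc.mono hsub
  set l : Fin n → ℝ → ℝ := fun i S => max 0 ((h i - a i * g S) / (vwapAverage f S - g S)) with hl
  set u : Fin n → ℝ → ℝ := fun i S => h i / vwapAverage f S with hu
  have hlc : ∀ i, ContinuousOn (l i) (Icc 0 (∑ i, a i)) := fun i =>
    continuousOn_const.sup ((continuousOn_const.sub (continuousOn_const.mul hgc')).div
      (hFc.sub hgc') fun S hS => (sub_pos.2 (hgf S hS)).ne')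
  have huc : ∀ i, ContinuousOn (u i) (Icc 0 (∑ i, a i)) := fun i =>
    continuousOn_const.div hFc fun S hS => (hf.vwapAverage_pos hS.1).ne'
  have hso : ∀ i, ∀ S ∈ Icc 0 (∑ i, a i), h i ≤ a i * vwapAverage f S := fun i S hS =>
    (hsolv i).trans (mul_le_mul_of_nonneg_left (hf.vwapAverage_antitone hS.1 hS.2) (ha i).le)
  have hua : ∀ i, ∀ S ∈ Icc 0 (∑ i, a i), u i S ≤ a i := fun i S hS =>
    (div_le_iff₀ (hf.vwapAverage_pos hS.1)).2 (hso i S hS)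
  have hupos : ∀ i, ∀ S ∈ Icc 0 (∑ i, a i), 0 < u i S := fun i S hS =>
    div_pos (hh i) (hf.vwapAverage_pos hS.1)
  have hlu : ∀ i, ∀ S ∈ Icc 0 (∑ i, a i), l i S ≤ u i S := by
    intro i S hS
    refine max_le (hupos i S hS).le ?_
    have h1 := hso i S hS
    have h2 := hgf S hS
    have h3 := hgpos S (hsub hS)
    have h4 := hf.vwapAverage_pos hS.1
    rw [hu, div_le_div_iff₀ (by linarith) h4]
    nlinarith
  -- The level `c` only has to locate the sign of the marginal price minus `ρ` at profiles of total
  -- `S`; clamping it between `l` and `u` then yields all four conditions.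
  have finish : ∀ S ∈ Icc 0 (∑ i, a i), ∀ c : ℝ, ∑ i, max (l i S) (min c (u i S)) = S →
      (∀ s : Fin n → ℝ, (∀ i, 0 ≤ s i) → ∑ i, s i = S → ∀ i,
        (c ≤ s i → vwapMarginal f i s ≤ ρ) ∧ (0 < s i → s i ≤ c → ρ ≤ vwapMarginal f i s)) →
      ∃ s, IsFirstOrderEquilibrium a h ρ (fun _ => vwapPrice f) (vwapMarginal f) g s := by
    intro S hS c hsum hcs
    set s : Fin n → ℝ := fun i => max (l i S) (min c (u i S)) with hs
    have hls : ∀ i, l i S ≤ s i := fun i => le_max_left _ _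
    have hsu : ∀ i, s i ≤ u i S := fun i => max_le (hlu i S hS) (min_le_right _ _)
    have h0 : ∀ i, 0 ≤ s i := fun i => (le_max_left _ _).trans (hls i)
    have hF := hf.vwapAverage_pos hS.1
    have hd := sub_pos.2 (hgf S hS)
    have hmem : s ∈ liquidationSet a := fun i => ⟨h0 i, (hsu i).trans (hua i S hS)⟩
    refine ⟨s, hmem, fun i => ?_, fun i => ?_, fun i hi => ?_, fun i hi0 hi => ?_⟩
    · rw [vwapPrice_eq f h0, hsum]
      exact (le_div_iff₀ hF).1 (hsu i)
    · rw [vwapPrice_eq f h0, hsum]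
      have := (div_le_iff₀ hd).1 ((le_max_right _ _).trans (hls i))
      linarith
    · rw [vwapPrice_eq f h0, hsum] at hi
      refine (hcs s h0 hsum i).1 ?_
      have h1 : s i < u i S := (lt_div_iff₀ hF).2 hi
      by_contra! hcon
      have : min c (u i S) ≤ s i := le_max_right _ _
      exact absurd this (not_le.2 (lt_min hcon h1))
    · rw [vwapPrice_eq f h0, hsum] at hi
      refine (hcs s h0 hsum i).2 hi0 ?_
      have h1 : l i S < s i := max_lt hi0 ((div_lt_iff₀ hd).2 (by linarith))
      rcases le_max_iff.1 (le_refl (s i)) with h2 | h2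
      · exact absurd h2 (not_le.2 h1)
      · exact h2.trans (min_le_left _ _)
  have hAmem : ∑ i, a i ∈ Icc 0 (∑ i, a i) := ⟨hA.le, le_rfl⟩
  -- For `ρ = 1` no marginal price exceeds `ρ`, so the level `0` works from `S = 0` on. For `ρ < 1`
  -- the level solving `(S - x) F + x f = ρ S` is `0 / 0` at `S = 0`, so the search starts at some
  -- `e > 0`.
  rcases hρ.eq_or_lt with rfl | hρ1
  · obtain ⟨S, hS, hsum⟩ := exists_clamp_sum_eq (a := a) (e := 0) (c := fun _ => 0) hA.le
      continuousOn_const hlc huc (fun i => (hlu i _ hAmem).trans (hua i _ hAmem))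
      (fun i => hua i _ hAmem)
      (Finset.sum_nonneg fun i _ => (le_max_left _ _).trans (le_max_left _ _))
    refine finish S hS 0 hsum fun s hs0 hsS i => ⟨fun _ => ?_, fun h1 h2 => absurd h1 (not_lt.2 h2)⟩
    rw [vwapMarginal, hsS]
    split_ifs with hS0
    · exact le_rfl
    · have hSpos : 0 < S := lt_of_le_of_ne hS.1 (Ne.symm hS0)
      have hle : s i ≤ S := hsS ▸ Finset.single_le_sum (fun j _ => hs0 j) (Finset.mem_univ i)
      rw [div_le_one hSpos]
      nlinarith [mul_nonneg (sub_nonneg.2 hle) (sub_nonneg.2 (hf.vwapAverage_le_one hS.1)),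
        mul_nonneg (hs0 i) (sub_nonneg.2 (hf.le_one S))]
  · obtain ⟨i0, hi0⟩ := Finite.exists_min h
    obtain ⟨d, hd, hd'⟩ := Metric.continuous_iff.1 hf.continuous 0 (1 - ρ) (by linarith)
    -- The first bound gives `ρ < f e`, hence a level of at least `e`. The second, with prices at
    -- most `1`, gives bank `i0` an upper bound of at least `e`. So the clamped sum at `e` is at
    -- least `e`.
    set e := min (d / 2) (min (h i0) (∑ i, a i)) with he
    have hepos : 0 < e := lt_min (by linarith) (lt_min (hh i0) hA)
    have hed : e ≤ d / 2 := min_le_left _ _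
    have heh : e ≤ h i0 := (min_le_right _ _).trans (min_le_left _ _)
    have heA : e ≤ ∑ i, a i := (min_le_right _ _).trans (min_le_right _ _)
    have hρe : ρ < f e := by
      have := hd' e (by rw [Real.dist_eq, abs_lt]; constructor <;> linarith)
      rw [Real.dist_eq, abs_lt, hf.at_zero] at this
      linarith [this.1]
    have hsub' : Icc e (∑ i, a i) ⊆ Icc 0 (∑ i, a i) := Icc_subset_Icc_left hepos.le
    have hlt : ∀ S ∈ Icc e (∑ i, a i), 0 < vwapAverage f S - f S := fun S hS =>
      sub_pos.2 (hf.lt_vwapAverage (hepos.trans_le hS.1) (hS.2.trans hM))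
    obtain ⟨S, hS, hsum⟩ := exists_clamp_sum_eq (a := a) (e := e)
      (c := fun S => S * (vwapAverage f S - ρ) / (vwapAverage f S - f S)) heA
      ((continuousOn_id.mul ((hFc.mono hsub').sub continuousOn_const)).div
        ((hFc.mono hsub').sub hf.continuous.continuousOn) fun S hS => (hlt S hS).ne')
      (fun i => (hlc i).mono hsub') (fun i => (huc i).mono hsub')
      (fun i => (hlu i _ hAmem).trans (hua i _ hAmem)) (fun i => hua i _ hAmem) (by
        have heI : e ∈ Icc e (∑ i, a i) := ⟨le_rfl, heA⟩
        refine le_trans ?_ (Finset.single_le_sum (fun i _ =>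
          (le_max_left _ _).trans (le_max_left _ _)) (Finset.mem_univ i0))
        refine le_max_of_le_right (le_min ?_ ?_)
        · rw [le_div_iff₀ (hlt e heI)]
          exact mul_le_mul_of_nonneg_left (by linarith) hepos.le
        · rw [hu, le_div_iff₀ (hf.vwapAverage_pos hepos.le)]
          nlinarith [hf.vwapAverage_le_one hepos.le])
    have hSpos := hepos.trans_le hS.1
    refine finish S (hsub' hS) _ hsum fun s hs0 hsS i => ?_
    rw [vwapMarginal, hsS, if_neg hSpos.ne', div_le_iff₀ (hlt S hS), div_le_iff₀ hSpos,
      le_div_iff₀ (hlt S hS), le_div_iff₀ hSpos]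
    exact ⟨fun _ => by linarith, fun _ _ => by linarith⟩


/-! ### Limit order book prices -/

/-- The depth of the book that has been consumed when each bank has traded `min (s j) t`. -/
noncomputable def lobDepth {n : ℕ} (s : Fin n → ℝ) (t : ℝ) : ℝ := ∑ j, min (s j) t

/-- The depth of the book consumed by the banks other than `i` when they have traded
`min (s j) t`. -/
noncomputable def othersDepth {n : ℕ} (s : Fin n → ℝ) (i : Fin n) (t : ℝ) : ℝ :=
  ∑ j ∈ Finset.univ \ {i}, min (s j) t

/-- The revenue of bank `i` from liquidating `x` in the limit order book. -/
noncomputable def lobRevenue {n : ℕ} (f : ℝ → ℝ) (s : Fin n → ℝ) (i : Fin n) (x : ℝ) : ℝ :=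
  ∫ t in (0 : ℝ)..x, f (t + othersDepth s i t)

/-- The marginal limit order book price of bank `i`. -/
noncomputable def lobMarginal {n : ℕ} (f : ℝ → ℝ) (i : Fin n) (s : Fin n → ℝ) : ℝ :=
  f (lobDepth s (s i))

theorem lobDepth_eq {n : ℕ} (s : Fin n → ℝ) (i : Fin n) (t : ℝ) :
    lobDepth s t = min (s i) t + othersDepth s i t := by
  rw [lobDepth, othersDepth, Finset.sdiff_singleton_eq_erase]
  exact (Finset.add_sum_erase _ (fun j => min (s j) t) (Finset.mem_univ i)).symm

theorem othersDepth_update {n : ℕ} (s : Fin n → ℝ) (i : Fin n) (x t : ℝ) :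
    othersDepth (Function.update s i x) i t = othersDepth s i t := by
  refine Finset.sum_congr rfl fun j hj => ?_
  rw [Function.update_of_ne (by simpa using hj)]

theorem lobDepth_mono {n : ℕ} (s : Fin n → ℝ) : Monotone (lobDepth s) := fun _ _ h =>
  Finset.sum_le_sum fun _ _ => min_le_min_left _ h

theorem continuous_lobDepth {n : ℕ} (s : Fin n → ℝ) : Continuous (lobDepth s) := by
  unfold lobDepth; fun_prop

theorem othersDepth_mono {n : ℕ} (s : Fin n → ℝ) (i : Fin n) : Monotone (othersDepth s i) :=
  fun _ _ h => Finset.sum_le_sum fun _ _ => min_le_min_left _ h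

theorem continuous_othersDepth {n : ℕ} (s : Fin n → ℝ) (i : Fin n) :
    Continuous (othersDepth s i) := by
  unfold othersDepth; fun_prop

theorem lobDepth_zero {n : ℕ} {s : Fin n → ℝ} (hs : ∀ i, 0 ≤ s i) : lobDepth s 0 = 0 :=
  Finset.sum_eq_zero fun i _ => min_eq_right (hs i)

theorem lobDepth_nonneg {n : ℕ} {s : Fin n → ℝ} (hs : ∀ i, 0 ≤ s i) {t : ℝ} (ht : 0 ≤ t) :
    0 ≤ lobDepth s t := Finset.sum_nonneg fun i _ => le_min (hs i) ht

theorem lobDepth_le {n : ℕ} (s : Fin n → ℝ) (t : ℝ) : lobDepth s t ≤ ∑ j, s j :=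
  Finset.sum_le_sum fun _ _ => min_le_left _ _

section OrderStatistics

variable {n : ℕ} {s : Fin n → ℝ}

theorem orderStat_succ (s : Fin n → ℝ) (k : Fin n) :
    orderStat s (k + 1) = s (Tuple.sort s k) := by
  simp [orderStat]

theorem orderStat_le_orderStat (hs : ∀ i, 0 ≤ s i) {j k : ℕ} (hjk : j ≤ k) (hk : k ≤ n) :
    orderStat s j ≤ orderStat s k := by
  rcases k with _ | k
  · rw [Nat.le_zero.1 hjk]
  · rw [orderStat_succ s ⟨k, hk⟩]
    rcases j with _ | j
    · exact hs _
    · rw [orderStat_succ s ⟨j, by omega⟩]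
      exact Tuple.monotone_sort s (by simpa using hjk)

theorem bookDepth_eq (s : Fin n → ℝ) (j : ℕ) :
    bookDepth s j = ∑ l ∈ Finset.range j, orderStat s (l + 1) + (n - j) * orderStat s j := by
  induction j with
  | zero => simp [bookDepth, orderStat]
  | succ j ih =>
    rw [bookDepth, Finset.sum_range_succ, ← bookDepth, ih, Finset.sum_range_succ]
    push_cast
    ring

/-- Between consecutive order statistics exactly the `n - j` largest sellers are still trading, so
the depth is affine with slope `n - j`. -/
theorem lobDepth_eq_bookDepth (hs : ∀ i, 0 ≤ s i) {j : ℕ} (hj : j < n) {t : ℝ}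
    (ht : t ∈ Icc (orderStat s j) (orderStat s (j + 1))) :
    lobDepth s t = bookDepth s j + (n - j) * (t - orderStat s j) := by
  have h1 : lobDepth s t = ∑ l ∈ Finset.range n, min (orderStat s (l + 1)) t := by
    rw [lobDepth, ← Equiv.sum_comp (Tuple.sort s), Finset.sum_range]
    exact Finset.sum_congr rfl fun k _ => by rw [orderStat_succ]
  rw [h1, ← Finset.sum_range_add_sum_Ico _ hj.le, bookDepth_eq]
  have h2 : ∑ l ∈ Finset.range j, min (orderStat s (l + 1)) t =
      ∑ l ∈ Finset.range j, orderStat s (l + 1) :=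
    Finset.sum_congr rfl fun l hl => min_eq_left
      ((orderStat_le_orderStat hs (Finset.mem_range.1 hl) hj.le).trans ht.1)
  have h3 : ∑ l ∈ Finset.Ico j n, min (orderStat s (l + 1)) t = (n - j) * t := by
    rw [Finset.sum_congr rfl fun l hl => min_eq_right (ht.2.trans
      (orderStat_le_orderStat hs (Nat.succ_le_succ (Finset.mem_Ico.1 hl).1)
        (Finset.mem_Ico.1 hl).2))]
    simp [Nat.cast_sub hj.le]
  rw [h2, h3]
  ring

theorem bookDepth_mem (hs : ∀ i, 0 ≤ s i) {j : ℕ} (hj : j ≤ n) :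
    bookDepth s j ∈ Icc 0 (∑ i, s i) := by
  have : bookDepth s j = lobDepth s (orderStat s j) := by
    rcases j with _ | j
    · simp [bookDepth, orderStat, lobDepth_zero hs]
    · rw [lobDepth_eq_bookDepth hs hj ⟨orderStat_le_orderStat hs (Nat.le_succ j) hj, le_rfl⟩,
        bookDepth, Finset.sum_range_succ, ← bookDepth]
  rw [this]
  have h0 : 0 ≤ orderStat s j := orderStat_le_orderStat hs (Nat.zero_le j) hj
  exact ⟨lobDepth_nonneg hs h0, lobDepth_le _ _⟩

theorem rank_le (s : Fin n → ℝ) (i : Fin n) : rank s i ≤ n := by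
  have := ((Tuple.sort s).symm i).2
  rw [rank]; omega

theorem lobPrice_congr (hs : ∀ i, 0 ≤ s i) {M : ℝ} (hM : ∑ i, s i ≤ M) {f f' : ℝ → ℝ}
    (hf : EqOn f f' (Icc 0 M)) (i : Fin n) : lobPrice f s i = lobPrice f' s i := by
  unfold lobPrice
  congr 2
  refine Finset.sum_congr rfl fun j hj => ?_
  congr 1
  have hj' := (Finset.mem_range.1 hj).trans_le (rank_le s i)
  refine intervalIntegral.integral_congr fun t ht => hf ?_
  have h1 := bookDepth_mem hs hj'.le
  have h2 := bookDepth_mem hs hj'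
  exact ⟨(le_min h1.1 h2.1).trans ht.1, ht.2.trans ((max_le h1.2 h2.2).trans hM)⟩

/-- Substituting the depth for `σ` on each interval between order statistics absorbs the factor `1 /
(n - j)`, and the pieces join up to one integral over `[0, s i]`. -/
theorem mul_lobPrice_eq_integral (hs : ∀ i, 0 ≤ s i) {f : ℝ → ℝ} (hf : Continuous f) (i : Fin n) :
    s i * lobPrice f s i = ∫ t in (0 : ℝ)..s i, f (lobDepth s t) := by
  by_cases h0 : s i = 0
  · simp [h0]
  have hc : Continuous fun t => f (lobDepth s t) := hf.comp (continuous_lobDepth s)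
  have hstep : ∀ j, j < n → 1 / ((n : ℝ) - (j : ℝ)) *
      ∫ σ in (bookDepth s j)..(bookDepth s (j + 1)), f σ =
      ∫ t in (orderStat s j)..(orderStat s (j + 1)), f (lobDepth s t) := by
    intro j hj
    have hne : (n : ℝ) - j ≠ 0 := sub_ne_zero.2 (by exact_mod_cast hj.ne')
    have hle := orderStat_le_orderStat hs (Nat.le_succ j) hj
    have e1 : ∫ t in (orderStat s j)..(orderStat s (j + 1)), f (lobDepth s t) =
        ∫ t in (orderStat s j)..(orderStat s (j + 1)),
          f (((n : ℝ) - j) * t + (bookDepth s j - ((n : ℝ) - j) * orderStat s j)) := by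
      refine intervalIntegral.integral_congr fun t ht => ?_
      rw [uIcc_of_le hle] at ht
      simp only [lobDepth_eq_bookDepth hs hj ht]
      congr 1
      ring
    have e2 : bookDepth s (j + 1) =
        bookDepth s j + ((n : ℝ) - j) * (orderStat s (j + 1) - orderStat s j) := by
      rw [bookDepth, Finset.sum_range_succ, ← bookDepth]
    rw [e1, intervalIntegral.integral_comp_mul_add f hne, smul_eq_mul, one_div, e2]
    congr 2 <;> ring
  rw [lobPrice, if_neg h0, ← mul_assoc, mul_one_div_cancel h0, one_mul,
    Finset.sum_congr rfl fun j hj => hstep j ((Finset.mem_range.1 hj).trans_le (rank_le s i)),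
    intervalIntegral.sum_integral_adjacent_intervals fun j _ => hc.intervalIntegrable _ _,
    orderStat_rank]
  rfl

end OrderStatistics

theorem mul_lobPrice {n : ℕ} {s : Fin n → ℝ} (hs : ∀ i, 0 ≤ s i) {f : ℝ → ℝ} (hf : Continuous f)
    (i : Fin n) : s i * lobPrice f s i = lobRevenue f s i (s i) := by
  rw [mul_lobPrice_eq_integral hs hf]
  refine intervalIntegral.integral_congr fun t ht => ?_
  rw [uIcc_of_le (hs i)] at ht
  simp only [lobDepth_eq s i, min_eq_right ht.2]

theorem lobMarginal_update {n : ℕ} (f : ℝ → ℝ) (s : Fin n → ℝ) (i : Fin n) (t : ℝ) :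
    lobMarginal f i (Function.update s i t) = f (t + othersDepth s i t) := by
  rw [lobMarginal, lobDepth_eq _ i, Function.update_self, min_self, othersDepth_update]

namespace IsRegularDensity

variable {M K : ℝ} {f : ℝ → ℝ} {n : ℕ}

theorem continuous_comp_others (hf : IsRegularDensity M K f) (s : Fin n → ℝ) (i : Fin n) :
    Continuous fun t => f (t + othersDepth s i t) :=
  hf.continuous.comp (continuous_id.add (continuous_othersDepth s i))

theorem antitone_comp_others (hf : IsRegularDensity M K f) (s : Fin n → ℝ) (i : Fin n) :
    Antitone fun t => f (t + othersDepth s i t) := fun _ _ h =>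
  hf.antitone (add_le_add h (othersDepth_mono s i h))

theorem isMarginalPrice_lob (hf : IsRegularDensity M K f) (a : Fin n → ℝ) :
    IsMarginalPrice a (fun i s => lobPrice f s i) (lobMarginal f) := by
  refine ⟨fun s hs i x hx => ?_, fun s hs i => ?_, fun s hs i => ?_⟩
  · have := mul_lobPrice (fun j => (update_mem_liquidationSet hs i hx j).1) hf.continuous i
    simp only [lobRevenue, othersDepth_update, Function.update_self] at this
    simp only [lobMarginal_update, this]
  · simp only [lobMarginal_update]
    exact (hf.continuous_comp_others s i).continuousOn
  · simp only [lobMarginal_update]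
    exact (hf.antitone_comp_others s i).antitoneOn _

theorem continuous_lobRevenue (hf : IsRegularDensity M K f) (s : Fin n → ℝ) (i : Fin n) :
    Continuous (lobRevenue f s i) :=
  intervalIntegral.continuous_primitive
    (fun _ _ => (hf.continuous_comp_others s i).intervalIntegrable _ _) 0

theorem lobRevenue_sub (hf : IsRegularDensity M K f) (s : Fin n → ℝ) (i : Fin n) (x y : ℝ) :
    lobRevenue f s i y - lobRevenue f s i x = ∫ t in x..y, f (t + othersDepth s i t) := by
  rw [lobRevenue, lobRevenue, intervalIntegral.integral_interval_sub_left] <;>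
    exact (hf.continuous_comp_others s i).intervalIntegrable _ _

theorem lobRevenue_strictMono (hf : IsRegularDensity M K f) (s : Fin n → ℝ) (i : Fin n) :
    StrictMono (lobRevenue f s i) := by
  intro x y hxy
  rw [← sub_pos, hf.lobRevenue_sub]
  exact intervalIntegral.intervalIntegral_pos_of_pos
    ((hf.continuous_comp_others s i).intervalIntegrable _ _) (fun t => hf.pos _) hxy

theorem lobRevenue_le_lobRevenue (hf : IsRegularDensity M K f) {s s' : Fin n → ℝ}
    (hss : ∀ j, s j ≤ s' j) (i : Fin n) {x : ℝ} (hx : 0 ≤ x) :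
    lobRevenue f s' i x ≤ lobRevenue f s i x := by
  refine intervalIntegral.integral_mono_on hx
    ((hf.continuous_comp_others s' i).intervalIntegrable _ _)
    ((hf.continuous_comp_others s i).intervalIntegrable _ _) fun t _ => hf.antitone ?_
  exact add_le_add_right (Finset.sum_le_sum fun j _ => min_le_min_right _ (hss j)) t

/-- More sales by the others lower the revenue for any given amount, and more own sales lower the
average of a decreasing marginal price. This carries solvency at `a` to every profile. -/
theorem lobPrice_le_lobPrice (hf : IsRegularDensity M K f) {a s : Fin n → ℝ} (ha : ∀ i, 0 < a i)
    (hs : s ∈ liquidationSet a) (i : Fin n) : lobPrice f a i ≤ lobPrice f s i := by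
  have h1 := mul_lobPrice (fun j => (ha j).le) hf.continuous i
  have h2 := mul_lobPrice (fun j => (hs j).1) hf.continuous i
  rcases (hs i).1.eq_or_lt with h0 | h0
  · have h3 : lobRevenue f a i (a i) ≤ a i := by
      have := (integral_le_of_antitoneOn (ha i).le (hf.continuous_comp_others a i).continuousOn
        ((hf.antitone_comp_others a i).antitoneOn _)).2
      rw [← lobRevenue] at this
      nlinarith [hf.le_one (0 + othersDepth a i 0), ha i]
    rw [lobPrice.eq_1 f s, if_pos h0.symm]
    rw [← h1] at h3
    exact le_of_mul_le_mul_left (by linarith) (ha i)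
  · have h3 := mul_integral_le_mul_integral (hf.continuous_comp_others a i)
      (hf.antitone_comp_others a i) (hs i).1 (hs i).2
    rw [← lobRevenue, ← lobRevenue, ← h1] at h3
    have h4 := hf.lobRevenue_le_lobRevenue (fun j => (hs j).2) i (hs i).1
    rw [← h2] at h4
    have h5 := mul_le_mul_of_nonneg_left h4 (ha i).le
    exact le_of_mul_le_mul_left (by linarith) (mul_pos (ha i) h0)

theorem lobPrice_le_one (hf : IsRegularDensity M K f) {s : Fin n → ℝ} (hs : ∀ i, 0 ≤ s i)
    (i : Fin n) : lobPrice f s i ≤ 1 := by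
  rcases (hs i).eq_or_lt with h0 | h0
  · rw [lobPrice, if_pos h0.symm]
  · have h1 := mul_lobPrice hs hf.continuous i
    have := (integral_le_of_antitoneOn (hs i) (hf.continuous_comp_others s i).continuousOn
        ((hf.antitone_comp_others s i).antitoneOn _)).2
    rw [← lobRevenue, ← h1] at this
    have h2 := hf.le_one (0 + othersDepth s i 0)
    exact le_of_mul_le_mul_left (by nlinarith) h0

end IsRegularDensity

/-- A least solution of a system of inequalities `0 ≤ Ψ i s (s i)`, where `Ψ` decreases in `s`. -/
theorem exists_least_solution {n : ℕ} {l a : Fin n → ℝ} (hla : ∀ i, l i ≤ a i)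
    (Ψ : Fin n → (Fin n → ℝ) → ℝ → ℝ)
    (hanti : ∀ i s s', (∀ j, s j ∈ Icc (l j) (a j)) → (∀ j, s' j ∈ Icc (l j) (a j)) →
      (∀ j, s j ≤ s' j) → ∀ x ∈ Icc (l i) (a i), Ψ i s' x ≤ Ψ i s x)
    (hcont : ∀ i s, (∀ j, s j ∈ Icc (l j) (a j)) → ContinuousOn (Ψ i s) (Icc (l i) (a i)))
    (htop : ∀ i s, (∀ j, s j ∈ Icc (l j) (a j)) → 0 ≤ Ψ i s (a i)) :
    ∃ s, (∀ j, s j ∈ Icc (l j) (a j)) ∧ ∀ i, 0 ≤ Ψ i s (s i) ∧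
      ∀ x ∈ Ico (l i) (s i), Ψ i s x < 0 := by
  have : ∀ i, Fact (l i ≤ a i) := fun i => ⟨hla i⟩
  set A : Fin n → (Fin n → ℝ) → Set ℝ := fun i s => {x | x ∈ Icc (l i) (a i) ∧ 0 ≤ Ψ i s x} with hA
  have hmem : ∀ i s, (∀ j, s j ∈ Icc (l j) (a j)) → sInf (A i s) ∈ A i s := by
    intro i s hs
    have hcl : IsClosed (A i s) :=
      (hcont i s hs).preimage_isClosed_of_isClosed isClosed_Icc isClosed_Ici
    exact hcl.csInf_mem ⟨a i, right_mem_Icc.2 (hla i), htop i s hs⟩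
      ⟨l i, fun x hx => hx.1.1⟩
  have hle : ∀ i s x, x ∈ A i s → sInf (A i s) ≤ x := fun i s x hx =>
    csInf_le ⟨l i, fun x hx => hx.1.1⟩ hx
  -- Knaster–Tarski on the product of intervals: `T` sends `s` to the least coordinatewise solutions
  -- against `s`, and is monotone because `Ψ` decreases in `s`.
  let T : (∀ i, Icc (l i) (a i)) →o (∀ i, Icc (l i) (a i)) :=
    ⟨fun s i => ⟨sInf (A i fun j => s j), (hmem i _ fun j => (s j).2).1⟩, fun s s' hss i => by
      have h1 := hmem i (fun j => s' j) fun j => (s' j).2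
      exact hle i _ _ ⟨h1.1, h1.2.trans
        (hanti i _ _ (fun j => (s j).2) (fun j => (s' j).2) (fun j => hss j) _ h1.1)⟩⟩
  have hfix : T (OrderHom.lfp T) = OrderHom.lfp T := OrderHom.map_lfp T
  set s := OrderHom.lfp T
  have hs : ∀ i, sInf (A i fun j => s j) = s i := fun i => congrArg Subtype.val (congrFun hfix i)
  refine ⟨fun j => s j, fun j => (s j).2, fun i => ⟨?_, fun x hx => ?_⟩⟩
  · have := (hmem i _ fun j => (s j).2).2
    rwa [hs i] at this
  · by_contra! hcon
    have := hle i (fun j => s j) x ⟨⟨hx.1, hx.2.le.trans (s i).2.2⟩, hcon⟩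
    rw [hs i] at this
    exact absurd hx.2 (not_lt.2 this)

theorem eq_zero_of_neg_left {φ : ℝ → ℝ} {l x u : ℝ} (hc : ContinuousOn φ (Icc l u)) (hlx : l < x)
    (hxu : x ≤ u) (h0 : 0 ≤ φ x) (hneg : ∀ y ∈ Ico l x, φ y < 0) : φ x = 0 := by
  refine le_antisymm ?_ h0
  have h1 : ContinuousWithinAt φ (Ico l x) x :=
    (hc x ⟨hlx.le, hxu⟩).mono fun y hy => ⟨hy.1, hy.2.le.trans hxu⟩
  have h2 : (nhdsWithin x (Ico l x)).NeBot := by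
    rw [← mem_closure_iff_nhdsWithin_neBot, closure_Ico hlx.ne]
    exact right_mem_Icc.2 hlx.le
  exact le_of_tendsto h1 (Filter.eventually_of_mem self_mem_nhdsWithin fun y hy => (hneg y hy).le)


namespace IsRegularDensity

variable {M K : ℝ} {f : ℝ → ℝ} {n : ℕ}

/-! ### Existence for the limit order book -/

/-- The profile `v` covers every shortfall by sales alone. Sales above the level `θ`, where the
marginal price along `v` meets `ρ`, are worthwhile only if the cash constraint forces them, so `v`
is truncated at `θ` and then raised minimally for the truncated banks. Raising above `θ` leaves
prices below `θ` untouched. -/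
theorem exists_lob (hf : IsRegularDensity M K f) {a h : Fin n → ℝ} (ha : ∀ i, 0 < a i)
    (hh : ∀ i, 0 < h i) (hM : ∑ i, a i ≤ M) {ρ : ℝ} (hρ : ρ ≤ 1) {g : ℝ → ℝ}
    (hgpos : ∀ S ∈ Icc 0 M, 0 < g S) (hganti : AntitoneOn g (Icc 0 M))
    (hsolv : ∀ i, h i ≤ a i * lobPrice f a i) :
    ∃ s, IsFirstOrderEquilibrium a h ρ (fun i s => lobPrice f s i) (lobMarginal f) g s := by
  have hsum : ∀ s ∈ liquidationSet a, ∑ j, s j ∈ Icc 0 M := fun s hs =>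
    ⟨Finset.sum_nonneg fun j _ => (hs j).1, (Finset.sum_le_sum fun j _ => (hs j).2).trans hM⟩
  have htop : ∀ i, ∀ s ∈ liquidationSet a, h i ≤ lobRevenue f s i (a i) := fun i s hs =>
    ((hsolv i).trans_eq (mul_lobPrice (fun j => (ha j).le) hf.continuous i)).trans
      (hf.lobRevenue_le_lobRevenue (fun j => (hs j).2) i (ha i).le)
  obtain ⟨v, hv, hv'⟩ := exists_least_solution (l := fun _ => 0) (a := a) (fun i => (ha i).le)
    (fun i s x => lobRevenue f s i x - h i)
    (fun i s s' _ _ hss x hx => sub_le_sub_right (hf.lobRevenue_le_lobRevenue hss i hx.1) _)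
    (fun i s _ => ((hf.continuous_lobRevenue s i).sub continuous_const).continuousOn)
    (fun i s hs => sub_nonneg.2 (htop i s hs))
  have hv0 : ∀ i, 0 ≤ v i := fun i => (hv i).1
  have hvh : ∀ i, lobRevenue f v i (v i) = h i := by
    intro i
    have hne : 0 < v i := by
      refine lt_of_le_of_ne (hv0 i) fun h0 => ?_
      have h1 := (hv' i).1
      rw [← h0] at h1
      simp only [lobRevenue, intervalIntegral.integral_same] at h1
      linarith [hh i]
    exact sub_eq_zero.1 (eq_zero_of_neg_left (φ := fun x => lobRevenue f v i x - h i)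
      (((hf.continuous_lobRevenue v i).sub continuous_const).continuousOn (s := Icc 0 (a i)))
      hne (hv i).2 (hv' i).1 (hv' i).2)
  obtain ⟨θ, hθ0, hθρ, hθ⟩ : ∃ θ, 0 ≤ θ ∧ ρ ≤ f (lobDepth v θ) ∧
      ((∃ i, θ < v i) → f (lobDepth v θ) = ρ) := by
    have hA : 0 ≤ ∑ i, a i := Finset.sum_nonneg fun i _ => (ha i).le
    rcases le_or_gt ρ (f (lobDepth v (∑ i, a i))) with h1 | h1
    · refine ⟨∑ i, a i, hA, h1, ?_⟩
      rintro ⟨i, hi⟩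
      have := (hv i).2.trans (Finset.single_le_sum (fun j _ => (ha j).le) (Finset.mem_univ i))
      exact absurd hi (not_lt.2 this)
    · have hc : ContinuousOn (fun t => f (lobDepth v t)) (Icc 0 (∑ i, a i)) :=
        (hf.continuous.comp (continuous_lobDepth v)).continuousOn
      obtain ⟨θ, hθ, hθρ⟩ := intermediate_value_Icc' hA hc
        (show ρ ∈ Icc _ _ from ⟨h1.le, by rw [lobDepth_zero hv0, hf.at_zero]; exact hρ⟩)
      exact ⟨θ, hθ.1, hθρ.ge, fun _ => hθρ⟩
  have hl0 : ∀ i, 0 ≤ min (v i) θ := fun i => le_min (hv0 i) hθ0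
  have hmemD : ∀ s : Fin n → ℝ, (∀ j, s j ∈ Icc (min (v j) θ) (a j)) → s ∈ liquidationSet a :=
    fun s hs j => ⟨(hl0 j).trans (hs j).1, (hs j).2⟩
  have hΨc : ∀ i s, Continuous fun x => if v i ≤ θ then (0 : ℝ) else
      lobRevenue f s i x + (a i - x) * g (∑ j, s j) - h i := by
    intro i s
    split_ifs
    · exact continuous_const
    · exact ((hf.continuous_lobRevenue s i).add (by fun_prop)).sub continuous_const
  -- Banks with `v i ≤ θ` get the void condition `0 ≤ 0`, so the least solution keeps them at `v i`.
  -- The condition for the others decreases in `s` because both revenue and haircut do.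
  obtain ⟨s, hs, hs'⟩ := exists_least_solution (l := fun i => min (v i) θ) (a := a)
    (fun i => (min_le_left _ _).trans (hv i).2)
    (fun i s x => if v i ≤ θ then 0 else
      lobRevenue f s i x + (a i - x) * g (∑ j, s j) - h i)
    (fun i s s' hs hs' hss x hx => by
      split_ifs
      · exact le_rfl
      · have h1 := hf.lobRevenue_le_lobRevenue hss i ((hl0 i).trans hx.1)
        have h2 := hganti (hsum s (hmemD s hs)) (hsum s' (hmemD s' hs'))
          (Finset.sum_le_sum fun j _ => hss j)
        have h3 := mul_le_mul_of_nonneg_left h2 (sub_nonneg.2 hx.2)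
        linarith)
    (fun i s _ => (hΨc i s).continuousOn)
    (fun i s hs => by
      split_ifs
      · exact le_rfl
      · have := htop i s (hmemD s hs)
        simpa using this)
  have hsD := hmemD s hs
  have hlow : ∀ i, v i ≤ θ → s i = v i := by
    intro i hi
    have h1 := (hs i).1
    rw [min_eq_left hi] at h1
    refine (h1.eq_of_not_lt fun hlt => ?_).symm
    have := (hs' i).2 (v i) ⟨by rw [min_eq_left hi], hlt⟩
    simp [hi] at this
  have hmin : ∀ j t, t ≤ θ → min (s j) t = min (v j) t := by
    intro j t ht
    rcases le_or_gt (v j) θ with h1 | h1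
    · rw [hlow j h1]
    · have h2 := (hs j).1
      rw [min_eq_right h1.le] at h2
      rw [min_eq_right (ht.trans h2), min_eq_right (ht.trans h1.le)]
  have hdepth : ∀ t, t ≤ θ → lobDepth s t = lobDepth v t := fun t ht =>
    Finset.sum_congr rfl fun j _ => hmin j t ht
  have hrev : ∀ i x, 0 ≤ x → x ≤ θ → lobRevenue f s i x = lobRevenue f v i x := by
    intro i x hx hxθ
    refine intervalIntegral.integral_congr fun t ht => ?_
    rw [uIcc_of_le hx] at ht
    have : othersDepth s i t = othersDepth v i t :=
      Finset.sum_congr rfl fun j _ => hmin j t (ht.2.trans hxθ)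
    simp only [this]
  have hq := hgpos _ (hsum s hsD)
  have hprice := fun i => mul_lobPrice (fun j => (hsD j).1) hf.continuous i
  have hhigh : ∀ i, θ < v i → θ ≤ s i ∧
      h i ≤ lobRevenue f s i (s i) + (a i - s i) * g (∑ j, s j) ∧
      (s i = θ ∨ h i = lobRevenue f s i (s i) + (a i - s i) * g (∑ j, s j)) := by
    intro i hi
    have h1 := (hs i).1
    have h2 := hs' i
    rw [min_eq_right hi.le] at h1
    refine ⟨h1, ?_, ?_⟩
    · have := h2.1
      rw [if_neg (not_le.2 hi)] at this
      linarith
    · rcases h1.eq_or_lt with h3 | h3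
      · exact Or.inl h3.symm
      · right
        have := eq_zero_of_neg_left ((hΨc i s).continuousOn (s := Icc (min (v i) θ) (a i)))
          (by rwa [min_eq_right hi.le]) (hs i).2 h2.1 h2.2
        simp only [if_neg (not_le.2 hi)] at this
        linarith
  refine ⟨s, hsD, fun i => ?_, fun i => ?_, fun i hi => ?_, fun i hi0 hi => ?_⟩
  · rw [hprice]
    rcases le_or_gt (v i) θ with h1 | h1
    · rw [hlow i h1, hrev i _ (hv0 i) h1, hvh]
    · obtain ⟨h2, h3, h4 | h4⟩ := hhigh i h1
      · rw [h4, hrev i θ hθ0 le_rfl, ← hvh i]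
        exact ((hf.lobRevenue_strictMono v i) h1).le
      · have := mul_nonneg (sub_nonneg.2 (hsD i).2) hq.le
        linarith
  · rw [hprice]
    rcases le_or_gt (v i) θ with h1 | h1
    · have := mul_nonneg (sub_nonneg.2 (hsD i).2) hq.le
      rw [hlow i h1, hrev i _ (hv0 i) h1, hvh]
      rw [hlow i h1] at this
      linarith
    · exact (hhigh i h1).2.1
  · rw [hprice] at hi
    rcases le_or_gt (v i) θ with h1 | h1
    · rw [hlow i h1, hrev i _ (hv0 i) h1, hvh] at hi
      exact absurd hi (lt_irrefl _)
    · rw [lobMarginal, ← hθ ⟨i, h1⟩, ← hdepth θ le_rfl]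
      exact hf.antitone (lobDepth_mono s (hhigh i h1).1)
  · rw [hprice] at hi
    have hsθ : s i ≤ θ := by
      rcases le_or_gt (v i) θ with h1 | h1
      · rwa [hlow i h1]
      · rcases (hhigh i h1).2.2 with h2 | h2
        · exact h2.le
        · exact absurd hi (not_lt.2 h2.ge)
    rw [lobMarginal, hdepth _ hsθ]
    exact hθρ.trans (hf.antitone (lobDepth_mono v hsθ))

/-! ### Uniqueness for the limit order book -/

/-- Where the profiles agree, revenues agree. At `s'` the bank thus has only the revenue of a
strictly smaller sale at `s`, and so falls short of its target. -/
theorem lob_marginal_le_of_agree (hf : IsRegularDensity M K f) {a h : Fin n → ℝ} {ρ : ℝ}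
    {g : ℝ → ℝ} {s s' : Fin n → ℝ}
    (hs : IsFirstOrderEquilibrium a h ρ (fun i s => lobPrice f s i) (lobMarginal f) g s)
    (hs' : IsFirstOrderEquilibrium a h ρ (fun i s => lobPrice f s i) (lobMarginal f) g s')
    {i : Fin n} (hi : s' i < s i) (hagree : ∀ j, ∀ t ≤ s' i, min (s j) t = min (s' j) t) :
    f (lobDepth s' (s' i)) ≤ ρ := by
  refine hs'.marg_le i ?_
  have h1 := hs.revenue_le i
  rw [mul_lobPrice (fun j => (hs.mem j).1) hf.continuous] at h1
  rw [mul_lobPrice (fun j => (hs'.mem j).1) hf.continuous]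
  have h2 := hf.lobRevenue_strictMono s i hi
  have h3 : lobRevenue f s i (s' i) = lobRevenue f s' i (s' i) := by
    refine intervalIntegral.integral_congr fun t ht => ?_
    rw [uIcc_of_le (hs'.mem i).1] at ht
    have : othersDepth s i t = othersDepth s' i t :=
      Finset.sum_congr rfl fun j _ => hagree j t ht.2
    simp only [this]
  linarith

/-- If a bank liquidates more in one equilibrium than in another one, it cannot meet its shortfall
with less. -/
theorem lob_cash_eq (hf : IsRegularDensity M K f) {a h : Fin n → ℝ} (hM : ∑ i, a i ≤ M) {ρ : ℝ}
    {g : ℝ → ℝ} {s s' : Fin n → ℝ}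
    (hs : IsFirstOrderEquilibrium a h ρ (fun i s => lobPrice f s i) (lobMarginal f) g s)
    (hs' : IsFirstOrderEquilibrium a h ρ (fun i s => lobPrice f s i) (lobMarginal f) g s')
    {i : Fin n} (hi : s' i < s i) :
    h i = s i * lobPrice f s i + (a i - s i) * g (∑ j, s j) := by
  -- Up to the lowest level `m` at which the two profiles separate, the truncated profiles agree.
  -- The bank that stops at `m` shows that the marginal price there is at most `ρ`.
  obtain ⟨k, hk, hkmin⟩ := Finset.exists_min_image (Finset.univ.filter fun j => s j ≠ s' j)
    (fun j => min (s j) (s' j)) ⟨i, by simp [hi.ne']⟩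
  have hk : s k ≠ s' k := by simpa using hk
  have hkmin : ∀ j, s j ≠ s' j → min (s k) (s' k) ≤ min (s j) (s' j) := fun j hj =>
    hkmin j (by simpa using hj)
  set m := min (s k) (s' k) with hm
  have hagree : ∀ j, ∀ t ≤ m, min (s j) t = min (s' j) t := by
    intro j t ht
    rcases eq_or_ne (s j) (s' j) with h1 | h1
    · rw [h1]
    · have := ht.trans (hkmin j h1)
      rw [min_eq_right (this.trans (min_le_left _ _)), min_eq_right (this.trans (min_le_right _ _))]
  have hdepth : lobDepth s m = lobDepth s' m :=
    Finset.sum_congr rfl fun j _ => hagree j m le_rfl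
  have hρ : f (lobDepth s m) ≤ ρ := by
    rcases lt_or_gt_of_ne hk with h1 | h1
    · have hmk : m = s k := min_eq_left h1.le
      rw [hmk]
      rw [hmk] at hagree
      exact hf.lob_marginal_le_of_agree hs' hs h1 fun j t ht => (hagree j t ht).symm
    · have hmk : m = s' k := min_eq_right h1.le
      rw [hdepth, hmk]
      rw [hmk] at hagree
      exact hf.lob_marginal_le_of_agree hs hs' h1 hagree
  have hm0 : 0 ≤ m := le_min (hs.mem k).1 (hs'.mem k).1
  have hmi : m < s i := ((hkmin i hi.ne').trans (min_le_right _ _)).trans_lt hi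
  -- Bank `i` trades beyond `m`, so its marginal price is strictly below `ρ`, and only a binding
  -- cash constraint explains its sales.
  have hlt : lobDepth s m < lobDepth s (s i) :=
    Finset.sum_lt_sum (fun j _ => min_le_min_left _ hmi.le)
      ⟨i, Finset.mem_univ i, by rwa [min_eq_right hmi.le, min_self]⟩
  have h0 := lobDepth_nonneg (fun j => (hs.mem j).1) hm0
  have hSM : lobDepth s (s i) ≤ M :=
    (lobDepth_le s _).trans ((Finset.sum_le_sum fun j _ => (hs.mem j).2).trans hM)
  have hflt := hf.strictAnti ⟨h0, hlt.le.trans hSM⟩ ⟨h0.trans hlt.le, hSM⟩ hlt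
  refine (hs.le_cash i).eq_of_not_lt fun hcash => ?_
  have := hs.le_marg i (hm0.trans_lt hmi) hcash
  rw [lobMarginal] at this
  linarith

theorem lobRevenue_sub_le (hf : IsRegularDensity M K f) (hK : 0 ≤ K) {a s s' : Fin n → ℝ}
    (hM : ∑ i, a i ≤ M) (hs : s ∈ liquidationSet a) (hs' : s' ∈ liquidationSet a) (i : Fin n)
    {x : ℝ} (hx : 0 ≤ x) (hxs : x ≤ s i) :
    lobRevenue f s' i x - lobRevenue f s i x ≤ x * (K * ∑ j, max (s j - s' j) 0) := by
  have hP : 0 ≤ K * ∑ j, max (s j - s' j) 0 :=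
    mul_nonneg hK (Finset.sum_nonneg fun j _ => le_max_right _ _)
  have hi := (hf.continuous_comp_others s i).intervalIntegrable (μ := MeasureTheory.volume) 0 x
  have hi' := (hf.continuous_comp_others s' i).intervalIntegrable (μ := MeasureTheory.volume) 0 x
  have := intervalIntegral.integral_mono_on hx (hi'.sub hi)
    (intervalIntegrable_const (c := K * ∑ j, max (s j - s' j) 0)) (fun t ht => by
      rcases le_total (othersDepth s i t) (othersDepth s' i t) with h1 | h1
      · have := hf.antitone (add_le_add_right h1 t)
        linarith
      · have h2 : 0 ≤ othersDepth s' i t := Finset.sum_nonneg fun j _ => le_min (hs' j).1 ht.1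
        have h3 : t + othersDepth s i t ≤ M := by
          have h4 := lobDepth_eq s i t
          rw [min_eq_right (ht.2.trans hxs)] at h4
          rw [← h4]
          exact (lobDepth_le s t).trans ((Finset.sum_le_sum fun j _ => (hs j).2).trans hM)
        refine (hf.sub_le (t + othersDepth s' i t) (t + othersDepth s i t)
          (by linarith [ht.1]) (by linarith) h3).trans (mul_le_mul_of_nonneg_left ?_ hK)
        calc t + othersDepth s i t - (t + othersDepth s' i t)
            = ∑ j ∈ Finset.univ \ {i}, (min (s j) t - min (s' j) t) := by
              rw [Finset.sum_sub_distrib, othersDepth, othersDepth]; ring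
          _ ≤ ∑ j ∈ Finset.univ \ {i}, max (s j - s' j) 0 := by
              refine Finset.sum_le_sum fun j _ => ?_
              rcases le_total (s j) t with h5 | h5 <;> rcases le_total (s' j) t with h6 | h6 <;>
                simp only [min_eq_left, min_eq_right, h5, h6] <;>
                first
                  | exact le_max_left _ _
                  | exact le_max_of_le_left (by linarith)
                  | exact le_max_of_le_right (by linarith)
          _ ≤ ∑ j, max (s j - s' j) 0 :=
              Finset.sum_le_sum_of_subset_of_nonneg (Finset.subset_univ _)
                fun j _ _ => le_max_right _ _)
  rw [intervalIntegral.integral_sub hi' hi, intervalIntegral.integral_const, sub_zero,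
    smul_eq_mul] at this
  exact this

/-- Let `P` be the sum of the positive parts of `s - s'`. A bank that sells more at `s` is cash
constrained there, and each extra unit brings in at least `c = f S - g S`. It only has to offset
price and haircut changes of size `μ P` on its holdings. Summing gives `P c ≤ M μ P`, which forces
`P = 0` since `M μ < c`. -/
theorem lob_le (hf : IsRegularDensity M K f) (hK : 0 ≤ K) {a h : Fin n → ℝ} (hM : ∑ i, a i ≤ M)
    {ρ μ : ℝ} (hKμ : K ≤ μ) {g : ℝ → ℝ} (hganti : AntitoneOn g (Icc 0 M))
    (hgsub : ∀ x y, 0 ≤ x → x ≤ y → y ≤ M → g x - g y ≤ μ * (y - x))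
    (hsmall : ∀ s ∈ liquidationSet a, M * μ < f (∑ j, s j) - g (∑ j, s j)) {s s' : Fin n → ℝ}
    (hs : IsFirstOrderEquilibrium a h ρ (fun i s => lobPrice f s i) (lobMarginal f) g s)
    (hs' : IsFirstOrderEquilibrium a h ρ (fun i s => lobPrice f s i) (lobMarginal f) g s') :
    ∀ i, s i ≤ s' i := by
  set P := ∑ j, max (s j - s' j) 0 with hP
  have hP0 : 0 ≤ P := Finset.sum_nonneg fun j _ => le_max_right _ _
  have hμ0 : 0 ≤ μ := hK.trans hKμ
  have hSmem : ∀ s ∈ liquidationSet a, ∑ j, s j ∈ Icc 0 M := fun s hs =>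
    ⟨Finset.sum_nonneg fun j _ => (hs j).1, (Finset.sum_le_sum fun j _ => (hs j).2).trans hM⟩
  have hS := hSmem s hs.mem
  have hS' := hSmem s' hs'.mem
  have hc := hsmall s hs.mem
  have hSP : ∑ j, s j - ∑ j, s' j ≤ P := by
    rw [← Finset.sum_sub_distrib]
    exact Finset.sum_le_sum fun j _ => le_max_left _ _
  have hgg : g (∑ j, s' j) - g (∑ j, s j) ≤ μ * P := by
    rcases le_total (∑ j, s j) (∑ j, s' j) with h1 | h1
    · have := hganti hS hS' h1
      have := mul_nonneg hμ0 hP0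
      linarith
    · exact (hgsub _ _ hS'.1 h1 hS.2).trans (mul_le_mul_of_nonneg_left hSP hμ0)
  set c := f (∑ j, s j) - g (∑ j, s j) with hcdef
  have hbank : ∀ i, max (s i - s' i) 0 * c ≤ a i * (μ * P) := by
    intro i
    have hai : 0 ≤ a i := (hs.mem i).1.trans (hs.mem i).2
    rcases le_or_gt (s i) (s' i) with h1 | h1
    · rw [max_eq_right (by linarith), zero_mul]
      exact mul_nonneg hai (mul_nonneg hμ0 hP0)
    rw [max_eq_left (by linarith)]
    have e1 := hf.lob_cash_eq hM hs hs' h1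
    have e2 := hs'.le_cash i
    rw [mul_lobPrice (fun j => (hs.mem j).1) hf.continuous] at e1
    rw [mul_lobPrice (fun j => (hs'.mem j).1) hf.continuous] at e2
    have e3 := hf.lobRevenue_sub_le hK hM hs.mem hs'.mem i (hs'.mem i).1 h1.le
    rw [← hP] at e3
    have e4 := (integral_le_of_antitoneOn h1.le (hf.continuous_comp_others s i).continuousOn
      ((hf.antitone_comp_others s i).antitoneOn _)).1
    rw [← hf.lobRevenue_sub] at e4
    have e5 : f (∑ j, s j) ≤ f (s i + othersDepth s i (s i)) := by
      have := lobDepth_eq s i (s i)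
      rw [min_self] at this
      rw [← this]
      exact hf.antitone (lobDepth_le _ _)
    have e6 := mul_le_mul_of_nonneg_left e5 (sub_nonneg.2 h1.le)
    have e7 := mul_le_mul_of_nonneg_left hgg (sub_nonneg.2 (hs'.mem i).2)
    have e8 := mul_le_mul_of_nonneg_left (mul_le_mul_of_nonneg_right hKμ hP0) (hs'.mem i).1
    rw [hcdef]
    linarith
  have hsum := Finset.sum_le_sum fun i (_ : i ∈ Finset.univ) => hbank i
  rw [← Finset.sum_mul, ← Finset.sum_mul, ← hP] at hsum
  have h1 := mul_le_mul_of_nonneg_right hM (mul_nonneg hμ0 hP0)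
  have hPz : P = 0 := by
    refine le_antisymm ?_ hP0
    by_contra! hcon
    have := mul_lt_mul_of_pos_left hc hcon
    linarith
  intro i
  have := (Finset.sum_eq_zero_iff_of_nonneg fun j _ => le_max_right _ _).1 hPz i (Finset.mem_univ i)
  have := this ▸ le_max_left (s i - s' i) 0
  linarith

end IsRegularDensity


/-! ### Existence and uniqueness of clearing prices -/

theorem IsMarginalPrice.congr {n : ℕ} {a : Fin n → ℝ} {fbar fbar' marg : Fin n → (Fin n → ℝ) → ℝ}
    (h : IsMarginalPrice a fbar marg)
    (heq : ∀ s ∈ liquidationSet a, ∀ i, fbar' i s = fbar i s) : IsMarginalPrice a fbar' marg :=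
  ⟨fun s hs i x hx => by
    rw [heq _ (update_mem_liquidationSet hs i hx), h.revenue_eq s hs i x hx],
    h.continuousOn, h.antitoneOn⟩

theorem IsFirstOrderEquilibrium.congr {n : ℕ} {a h : Fin n → ℝ} {ρ : ℝ}
    {fbar fbar' marg : Fin n → (Fin n → ℝ) → ℝ} {g : ℝ → ℝ} {s : Fin n → ℝ}
    (hs : IsFirstOrderEquilibrium a h ρ fbar marg g s)
    (heq : ∀ s ∈ liquidationSet a, ∀ i, fbar' i s = fbar i s) :
    IsFirstOrderEquilibrium a h ρ fbar' marg g s := by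
  have h0 := heq s hs.mem
  refine ⟨hs.mem, ?_, ?_, ?_, ?_⟩ <;> intro i <;> rw [h0]
  exacts [hs.revenue_le i, hs.le_cash i, hs.marg_le i, hs.le_marg i]

theorem existsUnique_isClearing {n : ℕ} {a h : Fin n → ℝ} {r : ℝ} (hr : 0 ≤ r) (hh : ∀ i, 0 < h i)
    {fbar fbar' marg : Fin n → (Fin n → ℝ) → ℝ} {g : ℝ → ℝ}
    (heq : ∀ s ∈ liquidationSet a, ∀ i, fbar i s = fbar' i s)
    (hmarg : IsMarginalPrice a fbar' marg)
    (hg : ∀ s ∈ liquidationSet a, 0 < g (∑ j, s j))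
    (hgf : ∀ s ∈ liquidationSet a, ∀ i, g (∑ j, s j) < fbar i s)
    (hsolv : ∀ s ∈ liquidationSet a, ∀ i, h i ≤ a i * fbar i s)
    (hex : ∃ s, IsFirstOrderEquilibrium a h (1 + r)⁻¹ fbar' marg g s)
    (huniq : ∀ s s', IsFirstOrderEquilibrium a h (1 + r)⁻¹ fbar' marg g s →
      IsFirstOrderEquilibrium a h (1 + r)⁻¹ fbar' marg g s' →
        ∑ j, s j = ∑ j, s' j ∧ ∀ i, fbar' i s = fbar' i s') :
    ∃! p : ℝ × (Fin n → ℝ), IsClearing a h r fbar g p := by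
  have hiff := isClearing_iff hr hh (hmarg.congr heq) hg hgf hsolv
  have heq' : ∀ s ∈ liquidationSet a, ∀ i, fbar' i s = fbar i s := fun s hs i => (heq s hs i).symm
  obtain ⟨s, hs⟩ := hex
  refine ⟨_, (hiff _).2 ⟨s, hs.congr heq, rfl⟩, fun p hp => ?_⟩
  obtain ⟨s', hs', rfl⟩ := (hiff p).1 hp
  obtain ⟨h1, h2⟩ := huniq s' s (hs'.congr heq') hs
  refine Prod.ext (by simp only [h1]) (funext fun i => ?_)
  simp only [heq s hs.mem, heq s' hs'.mem, h2]

theorem avgPrice_congr (m : Market) {n : ℕ} {a : Fin n → ℝ} {M : ℝ} (hM : ∑ i, a i ≤ M)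
    {f f' : ℝ → ℝ} (hf : EqOn f f' (Icc 0 M)) {s : Fin n → ℝ} (hs : s ∈ liquidationSet a)
    (i : Fin n) : m.avgPrice f i s = m.avgPrice f' i s := by
  have hS0 : 0 ≤ ∑ j, s j := Finset.sum_nonneg fun j _ => (hs j).1
  have hSM : ∑ j, s j ≤ M := (Finset.sum_le_sum fun j _ => (hs j).2).trans hM
  cases m with
  | vwap =>
    simp only [Market.avgPrice, vwapPrice]
    congr 2
    refine intervalIntegral.integral_congr fun t ht => hf ?_
    rw [uIcc_of_le hS0] at ht
    exact ⟨ht.1, ht.2.trans hSM⟩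
  | lob => exact lobPrice_congr (fun j => (hs j).1) hSM hf i

theorem IsRegularDensity.existsUnique_vwap {M K : ℝ} {f : ℝ → ℝ} (hf : IsRegularDensity M K f)
    {n : ℕ} (hn : 0 < n) {a h : Fin n → ℝ} (ha : ∀ i, 0 < a i) (hh : ∀ i, 0 < h i) {r : ℝ}
    (hr : 0 ≤ r) (hM : ∑ i, a i ≤ M) {g : ℝ → ℝ} {μ : ℝ} (hμ0 : 0 ≤ μ) (hKμ : K ≤ μ)
    (hgpos : ∀ S ∈ Icc 0 M, 0 < g S) (hgc : ContinuousOn g (Icc 0 M))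
    (hganti : AntitoneOn g (Icc 0 M))
    (hgsub : ∀ x y, 0 ≤ x → x ≤ y → y ≤ M → g x - g y ≤ μ * (y - x))
    {fbar : Fin n → (Fin n → ℝ) → ℝ}
    (heq : ∀ s ∈ liquidationSet a, ∀ i, fbar i s = vwapPrice f s)
    (hsmall : ∀ s ∈ liquidationSet a, M * μ < vwapPrice f s - g (∑ j, s j))
    (hsolv : ∀ i, h i ≤ a i * vwapPrice f a) :
    ∃! p : ℝ × (Fin n → ℝ), IsClearing a h r fbar g p := by
  have : Nonempty (Fin n) := ⟨⟨0, hn⟩⟩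
  have hA : 0 < ∑ i, a i := Finset.sum_pos (fun i _ => ha i) Finset.univ_nonempty
  have hMμ : 0 ≤ M * μ := mul_nonneg (hA.le.trans hM) hμ0
  have hsum : ∀ s ∈ liquidationSet a, ∑ j, s j ∈ Icc 0 (∑ i, a i) := fun s hs =>
    ⟨Finset.sum_nonneg fun j _ => (hs j).1, Finset.sum_le_sum fun j _ => (hs j).2⟩
  have hprice : ∀ s ∈ liquidationSet a, vwapPrice f s = vwapAverage f (∑ j, s j) := fun s hs =>
    vwapPrice_eq f fun i => (hs i).1
  rw [vwapPrice_eq f fun i => (ha i).le] at hsolv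
  have hgf : ∀ S ∈ Icc 0 (∑ i, a i), g S < vwapAverage f S := by
    intro S hS
    -- Every total `S` in the range is realized by selling proportionally to holdings.
    have hmem : (fun i => S / (∑ j, a j) * a i) ∈ liquidationSet a := fun i =>
      ⟨mul_nonneg (div_nonneg hS.1 hA.le) (ha i).le,
        mul_le_of_le_one_left (ha i).le ((div_le_one hA).2 hS.2)⟩
    have hSeq : ∑ i, S / (∑ j, a j) * a i = S := by
      rw [← Finset.mul_sum, div_mul_cancel₀ _ hA.ne']
    have := hsmall _ hmem
    rw [hprice _ hmem, hSeq] at this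
    linarith
  refine existsUnique_isClearing hr hh heq (hf.isMarginalPrice_vwap a)
    (fun s hs => hgpos _ ⟨(hsum s hs).1, (hsum s hs).2.trans hM⟩)
    (fun s hs i => by rw [heq s hs, hprice s hs]; exact hgf _ (hsum s hs))
    (fun s hs i => ?_)
    (hf.exists_vwap hn ha hh hM (inv_le_one_of_one_le₀ (by linarith)) hgpos hgc hgf hsolv)
    (fun s s' hs hs' => ?_)
  · rw [heq s hs, hprice s hs]
    exact (hsolv i).trans (mul_le_mul_of_nonneg_left
      (hf.vwapAverage_antitone (hsum s hs).1 (hsum s hs).2) (ha i).le)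
  · have hsmall' : ∀ s ∈ liquidationSet a,
        M * μ < vwapAverage f (∑ j, s j) - g (∑ j, s j) := fun s hs => hprice s hs ▸ hsmall s hs
    have hρ : (1 + r)⁻¹ ≤ 1 := inv_le_one_of_one_le₀ (by linarith)
    have hS : ∑ j, s j = ∑ j, s' j := le_antisymm
      (not_lt.1 (hf.not_vwap_lt hM hρ hμ0 hKμ hgpos hganti hgsub hsmall' hs' hs))
      (not_lt.1 (hf.not_vwap_lt hM hρ hμ0 hKμ hgpos hganti hgsub hsmall' hs hs'))
    exact ⟨hS, fun _ => by rw [hprice s hs.mem, hprice s' hs'.mem, hS]⟩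

/-- With one bank, the two profiles differ only in its own sales. The larger sale just meets the
shortfall, so by strict monotonicity of cash the smaller one misses it. -/
theorem IsRegularDensity.lob_single_le {M K : ℝ} {f : ℝ → ℝ} (hf : IsRegularDensity M K f)
    {n : ℕ} (hn : n = 1) {a h : Fin n → ℝ} (hM : ∑ i, a i ≤ M) {ρ : ℝ} {g : ℝ → ℝ}
    (hcash : CashStrictMono a (fun i s => lobPrice f s i) g) {s s' : Fin n → ℝ}
    (hs : IsFirstOrderEquilibrium a h ρ (fun i s => lobPrice f s i) (lobMarginal f) g s)
    (hs' : IsFirstOrderEquilibrium a h ρ (fun i s => lobPrice f s i) (lobMarginal f) g s')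
    (i : Fin n) : s i ≤ s' i := by
  subst hn
  by_contra! hcon
  have hup : Function.update s i (s' i) = s' := by
    ext j; rw [Subsingleton.elim j i, Function.update_self]
  have h1 := hcash i s hs.mem (hs'.mem i) (hs.mem i) hcon
  simp only [hup, Function.update_eq_self] at h1
  rw [← hf.lob_cash_eq hM hs hs' hcon] at h1
  exact absurd (hs'.le_cash i) (not_le.2 h1)

theorem IsRegularDensity.existsUnique_lob {M K : ℝ} {f : ℝ → ℝ} (hf : IsRegularDensity M K f)
    {n : ℕ} {a h : Fin n → ℝ} (ha : ∀ i, 0 < a i) (hh : ∀ i, 0 < h i) {r : ℝ}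
    (hr : 0 ≤ r) (hM : ∑ i, a i ≤ M) {g : ℝ → ℝ} {μ : ℝ} (hK : 0 ≤ K) (hKμ : K ≤ μ)
    (hgpos : ∀ S ∈ Icc 0 M, 0 < g S) (hganti : AntitoneOn g (Icc 0 M))
    (hgsub : ∀ x y, 0 ≤ x → x ≤ y → y ≤ M → g x - g y ≤ μ * (y - x))
    {fbar : Fin n → (Fin n → ℝ) → ℝ}
    (heq : ∀ s ∈ liquidationSet a, ∀ i, fbar i s = lobPrice f s i)
    (hgf : ∀ s ∈ liquidationSet a, ∀ i, g (∑ j, s j) < fbar i s)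
    (hcash : CashStrictMono a (fun i s => lobPrice f s i) g)
    (hsmall : n ≠ 1 → ∀ s ∈ liquidationSet a, M * μ < f (∑ j, s j) - g (∑ j, s j))
    (hsolv : ∀ i, h i ≤ a i * lobPrice f a i) :
    ∃! p : ℝ × (Fin n → ℝ), IsClearing a h r fbar g p := by
  have hle : ∀ s s', IsFirstOrderEquilibrium a h (1 + r)⁻¹ (fun i s => lobPrice f s i)
      (lobMarginal f) g s → IsFirstOrderEquilibrium a h (1 + r)⁻¹ (fun i s => lobPrice f s i)
      (lobMarginal f) g s' → ∀ i, s i ≤ s' i := by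
    intro s s' hs hs'
    by_cases hn : n = 1
    · exact hf.lob_single_le hn hM hcash hs hs'
    · exact hf.lob_le hK hM hKμ hganti hgsub (hsmall hn) hs hs'
  refine existsUnique_isClearing hr hh heq (hf.isMarginalPrice_lob a)
    (fun s hs => hgpos _ ⟨Finset.sum_nonneg fun j _ => (hs j).1,
      (Finset.sum_le_sum fun j _ => (hs j).2).trans hM⟩) hgf (fun s hs i => ?_)
    (hf.exists_lob ha hh hM (inv_le_one_of_one_le₀ (by linarith)) hgpos hganti hsolv)
    (fun s s' hs hs' => ?_)
  · rw [heq s hs]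
    exact (hsolv i).trans (mul_le_mul_of_nonneg_left (hf.lobPrice_le_lobPrice ha hs i) (ha i).le)
  · have : s = s' := funext fun i => le_antisymm (hle s s' hs hs' i) (hle s' s hs' hs i)
    subst this
    exact ⟨rfl, fun _ => rfl⟩

end RepoFireSale

theorem theorem3 (m : RepoFireSale.Market) (n : ℕ) (hn : 0 < n)
    (a h : Fin n → ℝ) (ha : ∀ i, 0 < a i) (hh : ∀ i, 0 < h i)
    (r : ℝ) (hr : 0 ≤ r)
    (M : ℝ) (hM : ∑ i, a i ≤ M)
    (f g : ℝ → ℝ)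
    (hf : RepoFireSale.IsOrderBookDensity M f)
    (hg : RepoFireSale.IsHaircut M a (m.avgPrice f) g)
    (hcash : RepoFireSale.CashStrictMono a (m.avgPrice f) g)
    (hsolv : ∀ i, RepoFireSale.FundamentallySolvent a h (m.avgPrice f) i)
    (hg' : DifferentiableWithinAt ℝ g (Set.Icc 0 M) 0)
    (hsmall : ∀ j, ∀ s ∈ RepoFireSale.liquidationSet a,
      -(m.c n) * M * min (m.c₁ n * derivWithin f (Set.Icc 0 M) 0) (derivWithin g (Set.Icc 0 M) 0)
        < m.avgPrice f j s - g (∑ i, s i)) :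
    ∃! p : ℝ × (Fin n → ℝ), RepoFireSale.IsClearing a h r (m.avgPrice f) g p := by
  have i₀ : Fin n := ⟨0, hn⟩
  have hMpos : 0 < M := (Finset.sum_pos (fun i _ => ha i) ⟨i₀, Finset.mem_univ _⟩).trans_le hM
  have hreg := hf.isRegularDensity hMpos
  have hK := hreg.nonneg_of_pos hMpos
  have hext : Set.EqOn f (RepoFireSale.clampExtend M f) (Set.Icc 0 M) := fun x hx =>
    (RepoFireSale.clampExtend_of_mem hx).symm
  have hcongr := fun s hs i => RepoFireSale.avgPrice_congr m (a := a) (s := s) hM hext hs i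
  have haD : a ∈ RepoFireSale.liquidationSet a := fun i => ⟨(ha i).le, le_rfl⟩
  have hgpos : ∀ S ∈ Set.Icc 0 M, 0 < g S := fun S hS => (hg.mapsTo hS).1
  have hganti := hg.strictAnti.antitoneOn
  have hgsub' : ∀ x y, 0 ≤ x → x ≤ y → y ≤ M →
      g x - g y ≤ -derivWithin g (Set.Icc 0 M) 0 * (y - x) := fun x y hx hxy hy =>
    RepoFireSale.sub_le_of_convexOn hMpos hg.convexOn hg' hx hxy hy
  set K := -derivWithin f (Set.Icc 0 M) 0 with hKdef
  set G := -derivWithin g (Set.Icc 0 M) 0 with hGdef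
  have hgsub : ∀ x y, 0 ≤ x → x ≤ y → y ≤ M → g x - g y ≤ max K G * (y - x) :=
    fun x y hx hxy hy => (hgsub' x y hx hxy hy).trans
      (mul_le_mul_of_nonneg_right (le_max_right _ _) (sub_nonneg.2 hxy))
  have hKμ : K ≤ max K G := le_max_left _ _
  have hμ0 : 0 ≤ max K G := hK.trans hKμ
  set w := min (m.c₁ n * derivWithin f (Set.Icc 0 M) 0) (derivWithin g (Set.Icc 0 M) 0) with hw
  have hw1 : w ≤ m.c₁ n * -K := by rw [hKdef, neg_neg]; exact min_le_left _ _
  have hw2 : w ≤ -G := by rw [hGdef, neg_neg]; exact min_le_right _ _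
  cases m with
  | vwap =>
    refine hreg.existsUnique_vwap hn ha hh hr hM hμ0 hKμ hgpos hg.continuousOn hganti hgsub
      hcongr (fun s hs => ?_) (fun i => (hsolv i).trans_eq (by rw [hcongr a haD]; rfl))
    have h1 := hsmall i₀ s hs
    rw [hcongr s hs] at h1
    simp only [RepoFireSale.Market.c, RepoFireSale.Market.c₁] at h1 hw1
    have h2 : max K G ≤ -3 * w := max_le (by linarith) (by linarith)
    have h3 := mul_le_mul_of_nonneg_left h2 hMpos.le
    exact lt_of_le_of_lt (by linarith) h1
  | lob =>
    refine hreg.existsUnique_lob ha hh hr hM hK hKμ hgpos hganti hgsub hcongr hg.lt_price ?_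
      (fun hn1 s hs => ?_) (fun i => (hsolv i).trans_eq (by rw [hcongr a haD]; rfl))
    · intro i s hs x hx y hy hxy
      have hlt := hcash i s hs hx hy hxy
      have hux := RepoFireSale.update_mem_liquidationSet hs i hx
      have huy := RepoFireSale.update_mem_liquidationSet hs i hy
      simp only [hcongr _ hux, hcongr _ huy] at hlt
      exact hlt
    · have h1 := hsmall i₀ s hs
      rw [hcongr s hs] at h1
      simp only [RepoFireSale.Market.c, RepoFireSale.Market.c₁, RepoFireSale.Market.avgPrice]
        at h1 hw1
      have hn2 : (2 : ℝ) ≤ n := by exact_mod_cast (show 2 ≤ n by omega)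
      have h2 : max K G ≤ -w := max_le (by nlinarith) (by linarith)
      -- For `n ≥ 2` the constants give `2 M μ < f̄ - g` with `μ = max K G`. As `f̄ ≤ 1` and `f S ≥
      -- 1 - K S ≥ 1 - M μ`, one copy of `M μ` pays for replacing the average price by `f S`.
      have h3 : M * (2 * max K G) ≤ M * (n * -w) :=
        mul_le_mul_of_nonneg_left (mul_le_mul hn2 h2 hμ0 (by linarith)) hMpos.le
      have h4 := hreg.lobPrice_le_one (fun j => (hs j).1) i₀
      have hS0 : 0 ≤ ∑ j, s j := Finset.sum_nonneg fun j _ => (hs j).1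
      have hSM : ∑ j, s j ≤ M := (Finset.sum_le_sum fun j _ => (hs j).2).trans hM
      have h5 := hreg.sub_le 0 _ le_rfl hS0 hSM
      rw [hreg.at_zero, sub_zero] at h5
      have h6 : K * ∑ j, s j ≤ max K G * M := mul_le_mul hKμ hSM hS0 hμ0
      linarith
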